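/- Consider the linear time-invariant system $\dot x(t)=Ax(t)+Bu(t)$, $y(t)=Cx(t)$, $t\ge 0$, with $A\in\mathbb R^{n\times n}$, $B\in\mathbb R^{n\times m}$, $C\in\mathbb R^{m\times n}$, and suppose that it is controllable and observable. Let $G(s)=C(sI-A)^{-1}B$ be its transfer function. Call a square real-rational matrix $G(s)$ negative imaginary if 1. $G(s)$ has no pole at $s=0$ and no pole with $\operatorname{Re}s>0$; 2. for every $\omega>0$ such that $j\omega$ is not a pole of $G$, the matrix $j\omega\,(G(j\omega)-G(j\omega)^{*})$ is positive semidefinite, where ${}^{*}$ denotes the conjugate transpose; 3. if $j\omega_0$ with $\omega_0>0$ is a pole of $G$, then it is a simple pole and $K_0=\lim_{s\to j\omega_0}(s-j\omega_0)\,s\,G(s)$ is Hermitian positive semidefinite. Then $G(s)$ is negative imaginary if and only if there exists a real symmetric positive definite matrix $P\in\mathbb R^{n\times n}$ such that the function $V(x)=\tfrac12x^{T}Px$ satisfies $$\frac{d}{dt}V(x(t))\le \dot y(t)^{T}u(t)\qquad\text{for all } t\ge 0$$ along every trajectory of the system with continuous input $u$. -/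

import Mathlib

open scoped Matrix Topology ComplexOrder

noncomputable section

namespace NegImag

variable {n m : ℕ}

/-- `x` is a (classical) trajectory on `t ≥ 0` of the linear system `x' = A x + B u`
for the continuous input `u`. The derivative at `t = 0` is the right derivative. -/
structure IsTrajectory (A : Matrix (Fin n) (Fin n) ℝ) (B : Matrix (Fin n) (Fin m) ℝ)
    (u : ℝ → Fin m → ℝ) (x : ℝ → Fin n → ℝ) : Prop where
  input_continuous : ContinuousOn u (Set.Ici 0)
  state_eq : ∀ t : ℝ, 0 ≤ t → HasDerivWithinAt x (A *ᵥ x t + B *ᵥ u t) (Set.Ici 0) t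

/-- Controllability: every state can be steered to every other state in finite time. -/
def Controllable (A : Matrix (Fin n) (Fin n) ℝ) (B : Matrix (Fin n) (Fin m) ℝ) : Prop :=
  ∀ x₀ x₁ : Fin n → ℝ, ∃ (u : ℝ → Fin m → ℝ) (x : ℝ → Fin n → ℝ) (T : ℝ),
    IsTrajectory A B u x ∧ 0 ≤ T ∧ x 0 = x₀ ∧ x T = x₁

/-- Observability: the input and the output `y = C x` on `t ≥ 0` determine the initial state. -/
def Observable (A : Matrix (Fin n) (Fin n) ℝ) (B : Matrix (Fin n) (Fin m) ℝ)
    (C : Matrix (Fin m) (Fin n) ℝ) : Prop :=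
  ∀ (u : ℝ → Fin m → ℝ) (x z : ℝ → Fin n → ℝ),
    IsTrajectory A B u x → IsTrajectory A B u z →
    (∀ t : ℝ, 0 ≤ t → C *ᵥ x t = C *ᵥ z t) → x 0 = z 0

/-- The transfer function `G(s) = C (s I - A)⁻¹ B`, a matrix of real rational functions
(the determinant of `s I - A` is a nonzero element of the field `ℝ(s)`). -/
def transferFunction (A : Matrix (Fin n) (Fin n) ℝ) (B : Matrix (Fin n) (Fin m) ℝ)
    (C : Matrix (Fin m) (Fin n) ℝ) : Matrix (Fin m) (Fin m) (RatFunc ℝ) :=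
  C.map RatFunc.C * (Matrix.scalar (Fin n) RatFunc.X - A.map RatFunc.C)⁻¹ * B.map RatFunc.C

/-- `s` is a pole of the real rational matrix `G`: it is a zero of the reduced denominator
of some entry. -/
def IsPole (G : Matrix (Fin m) (Fin m) (RatFunc ℝ)) (s : ℂ) : Prop :=
  ∃ i j, (G i j).denom.eval₂ (algebraMap ℝ ℂ) s = 0

/-- The value `G(s)` of the real rational matrix `G` at a complex point `s`
(meaningful when `s` is not a pole). -/
def evalAt (G : Matrix (Fin m) (Fin m) (RatFunc ℝ)) (s : ℂ) : Matrix (Fin m) (Fin m) ℂ :=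
  Matrix.of fun i j => (G i j).eval (algebraMap ℝ ℂ) s

/-- Negative imaginary real rational matrices. -/
structure IsNegativeImaginary (G : Matrix (Fin m) (Fin m) (RatFunc ℝ)) : Prop where
  no_pole_zero : ¬ IsPole G 0
  no_pole_right : ∀ s : ℂ, 0 < s.re → ¬ IsPole G s
  nonneg : ∀ ω : ℝ, 0 < ω → ¬ IsPole G (Complex.I * ω) →
    ((Complex.I * ω) •
      (evalAt G (Complex.I * ω) - (evalAt G (Complex.I * ω))ᴴ)).PosSemidef
  /-- A pole `i ω₀`, `ω₀ > 0`, is at most simple, which is the existence of the limit,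
  and the limit is Hermitian positive semidefinite. -/
  residue : ∀ ω₀ : ℝ, 0 < ω₀ → IsPole G (Complex.I * ω₀) →
    ∃ K₀ : Matrix (Fin m) (Fin m) ℂ,
      Filter.Tendsto (fun s : ℂ => ((s - Complex.I * ω₀) * s) • evalAt G s)
        (𝓝[≠] (Complex.I * ω₀)) (𝓝 K₀) ∧ K₀.PosSemidef

/-- The quadratic storage function `V(x) = ½ xᵀ P x`. -/
def storage (P : Matrix (Fin n) (Fin n) ℝ) (x : Fin n → ℝ) : ℝ :=
  (1 / 2) * (x ⬝ᵥ (P *ᵥ x))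

/-- Along every trajectory of `x' = A x + B u`, `y = C x`, both `V(x(t))` and `y(t)` are
differentiable at every `t ≥ 0` and `d/dt V(x(t)) ≤ y'(t)ᵀ u(t)`. -/
def Dissipative (A : Matrix (Fin n) (Fin n) ℝ) (B : Matrix (Fin n) (Fin m) ℝ)
    (C : Matrix (Fin m) (Fin n) ℝ) (V : (Fin n → ℝ) → ℝ) : Prop :=
  ∀ (u : ℝ → Fin m → ℝ) (x : ℝ → Fin n → ℝ), IsTrajectory A B u x →
    ∀ t : ℝ, 0 ≤ t → ∃ (V' : ℝ) (y' : Fin m → ℝ),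
      HasDerivWithinAt (fun τ => V (x τ)) V' (Set.Ici 0) t ∧
      HasDerivWithinAt (fun τ => C *ᵥ x τ) y' (Set.Ici 0) t ∧
      V' ≤ y' ⬝ᵥ u t

end NegImag

end

/-! Constant inputs reach every pair (x, u) at time 0, so dissipation along trajectories is the
algebraic inequality xᵀP(Ax + Bu) ≤ (C(Ax + Bu))ᵀu (`dissipative_iff`); the theorem is thus a
positive real lemma for s G(s). The inequality passes to complex vectors, and wherever it is an
equality at (v, 0) its first variation vanishes (`StorageInequality.variation`). This settles the
borderline cases: the eigenvalue 0, imaginary eigenvalues, and the kernel of P. Controllability and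
observability make the poles of G exactly the eigenvalues of A (`isPole_iff`).

From P to G: when (s - A)x = Bu, the inequality reads Re s · x*Px ≤ Re(s u*G(s)u). This gives the
condition on the imaginary axis and, in the limit from the right half-plane, the sign of K₀. Poles
on the axis are simple because the resolvent is O(1 / Re s) for Re s > 0
(`StorageInequality.resolvent_bound`).

From G to P: continuity carries the sign condition across poles and to infinite frequency, giving
`FrequencyInequality`. A Hahn–Banach separation in the space of pairs (supply, symmetrized moment of
x and ẋ) then produces P. The disjointness it needs is `FrequencyInequality.trace_nonneg`: a family
with vanishing moment is split by the eigenbasis of an isometry into sinusoidal modes. Separation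
costs a slack δ, removed by compactness. The resulting P is only symmetric. Its positivity comes
from a Lyapunov argument (`energy_nonneg_of_lyapunov`) in which imaginary eigenvectors get positive
energy from the residues (`energy_pos_of_residue`); observability excludes a kernel. -/

namespace NegImag

/-! ### Complexified matrices and Hermitian forms -/

section Complexification

variable {k l : Type*}

/-- The complexification of a real matrix. -/
abbrev toC (A : Matrix k l ℝ) : Matrix k l ℂ := A.map Complex.ofReal

/-- The entrywise real part of a complex vector. -/
def reV (x : l → ℂ) : l → ℝ := fun i => (x i).re

/-- The entrywise imaginary part of a complex vector. -/
def imV (x : l → ℂ) : l → ℝ := fun i => (x i).im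

/-- The complexification of a real vector. -/
def vecC (x : l → ℝ) : l → ℂ := fun i => (x i : ℂ)

@[simp] lemma reV_add (x y : l → ℂ) : reV (x + y) = reV x + reV y := by
  ext i; simp [reV]

@[simp] lemma imV_add (x y : l → ℂ) : imV (x + y) = imV x + imV y := by
  ext i; simp [imV]

@[simp] lemma reV_vecC (x : l → ℝ) : reV (vecC x) = x := by ext i; simp [reV, vecC]

@[simp] lemma imV_vecC (x : l → ℝ) : imV (vecC x) = 0 := by ext i; simp [imV, vecC]

lemma eq_zero_of_reV_imV {x : l → ℂ} (h1 : reV x = 0) (h2 : imV x = 0) : x = 0 := by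
  ext i
  exact Complex.ext (congrFun h1 i) (congrFun h2 i)

@[simp] lemma reV_toC_mulVec [Fintype l] (A : Matrix k l ℝ) (x : l → ℂ) :
    reV (toC A *ᵥ x) = A *ᵥ reV x := by
  ext i; simp [reV, Matrix.mulVec, dotProduct]

@[simp] lemma imV_toC_mulVec [Fintype l] (A : Matrix k l ℝ) (x : l → ℂ) :
    imV (toC A *ᵥ x) = A *ᵥ imV x := by
  ext i; simp [imV, Matrix.mulVec, dotProduct]

lemma toC_mulVec_vecC [Fintype l] (A : Matrix k l ℝ) (x : l → ℝ) :
    toC A *ᵥ vecC x = vecC (A *ᵥ x) := by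
  ext i; simp [vecC, Matrix.mulVec, dotProduct]

lemma re_star_dotProduct [Fintype l] (x y : l → ℂ) :
    (star x ⬝ᵥ y).re = reV x ⬝ᵥ reV y + imV x ⬝ᵥ imV y := by
  simp [dotProduct, reV, imV, Finset.sum_add_distrib]

lemma star_toC_mulVec [Fintype l] (A : Matrix k l ℝ) (x : l → ℂ) :
    star (toC A *ᵥ x) = toC A *ᵥ star x := by
  ext i; simp [Matrix.mulVec, dotProduct]

lemma star_star_dotProduct [Fintype l] (x y : l → ℂ) :
    star (star x ⬝ᵥ y) = star y ⬝ᵥ x := by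
  rw [Matrix.star_dotProduct, star_star]

lemma toC_mulVec_dotProduct [Fintype k] [Fintype l] (A : Matrix k l ℝ) (x : l → ℂ) (y : k → ℂ) :
    (toC A *ᵥ x) ⬝ᵥ y = x ⬝ᵥ (toC Aᵀ *ᵥ y) := by
  rw [show toC Aᵀ = (toC A)ᵀ from rfl, Matrix.mulVec_transpose, dotProduct_comm,
    Matrix.dotProduct_mulVec, dotProduct_comm]

/-- The Hermitian form of a real symmetric matrix. -/
lemma star_dotProduct_symm [Fintype l] {P : Matrix l l ℝ} (hP : P.IsSymm) (x y : l → ℂ) :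
    star (star x ⬝ᵥ (toC P *ᵥ y)) = star y ⬝ᵥ (toC P *ᵥ x) := by
  rw [star_star_dotProduct, star_toC_mulVec, toC_mulVec_dotProduct, hP.eq]

end Complexification

/-! ### The pointwise dissipation inequality and its first variation -/

variable {n m : ℕ}

/-- The pointwise form of the dissipation inequality for the storage function `½ xᵀ P x`. -/
def StorageInequality (A : Matrix (Fin n) (Fin n) ℝ) (B : Matrix (Fin n) (Fin m) ℝ)
    (C : Matrix (Fin m) (Fin n) ℝ) (P : Matrix (Fin n) (Fin n) ℝ) : Prop :=
  ∀ (x : Fin n → ℝ) (u : Fin m → ℝ),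
    x ⬝ᵥ (P *ᵥ (A *ᵥ x + B *ᵥ u)) ≤ (C *ᵥ (A *ᵥ x + B *ᵥ u)) ⬝ᵥ u

variable {A : Matrix (Fin n) (Fin n) ℝ} {B : Matrix (Fin n) (Fin m) ℝ}
  {C : Matrix (Fin m) (Fin n) ℝ} {P : Matrix (Fin n) (Fin n) ℝ}

/-- Both sides split as a sum over the real and imaginary parts, and the real inequality applies to
each. -/
lemma StorageInequality.complex (h : StorageInequality A B C P) (x : Fin n → ℂ)
    (u : Fin m → ℂ) :
    (star x ⬝ᵥ (toC P *ᵥ (toC A *ᵥ x + toC B *ᵥ u))).re ≤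
      (star (toC C *ᵥ (toC A *ᵥ x + toC B *ᵥ u)) ⬝ᵥ u).re := by
  rw [re_star_dotProduct, re_star_dotProduct]
  simp only [reV_toC_mulVec, imV_toC_mulVec, reV_add, imV_add]
  exact add_le_add (h _ _) (h _ _)

/-- A real quadratic polynomial without constant term that is nonnegative has no linear term. -/
lemma linear_eq_zero_of_nonneg {a b : ℝ} (h : ∀ t : ℝ, 0 ≤ t * a + t ^ 2 * b) : a = 0 := by
  -- At this t the linear term outweighs the quadratic one, whatever the sign of b.
  have h1 := h (-a / (2 * (|b| + 1)))
  have hb : 0 < |b| + 1 := by positivity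
  by_contra ha
  have ha2 : 0 < a ^ 2 := by positivity
  have h2 : -a / (2 * (|b| + 1)) * a + (-a / (2 * (|b| + 1))) ^ 2 * b
      = (a ^ 2 / (4 * (|b| + 1) ^ 2)) * (b - 2 * (|b| + 1)) := by
    field_simp; ring
  rw [h2] at h1
  have h3 : 0 < a ^ 2 / (4 * (|b| + 1) ^ 2) := by positivity
  nlinarith [le_abs_self b, abs_nonneg b]

/-- If the dissipation inequality is an equality at `(v, 0)`, then its first variation there
vanishes. -/
lemma StorageInequality.variation (h : StorageInequality A B C P) (hP : P.IsSymm)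
    {v : Fin n → ℂ} (hv : (star v ⬝ᵥ (toC P *ᵥ (toC A *ᵥ v))).re = 0)
    (x : Fin n → ℂ) (u : Fin m → ℂ) :
    star (toC C *ᵥ (toC A *ᵥ v)) ⬝ᵥ u
      = star v ⬝ᵥ (toC P *ᵥ (toC A *ᵥ x + toC B *ᵥ u)) + star (toC A *ᵥ v) ⬝ᵥ (toC P *ᵥ x) := by
  have key : ∀ (x : Fin n → ℂ) (u : Fin m → ℂ),
      (star (toC C *ᵥ (toC A *ᵥ v)) ⬝ᵥ u
      - star v ⬝ᵥ (toC P *ᵥ (toC A *ᵥ x + toC B *ᵥ u))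
      - star (toC A *ᵥ v) ⬝ᵥ (toC P *ᵥ x)).re = 0 := by
    intro x u
    apply linear_eq_zero_of_nonneg (b := (star (toC C *ᵥ (toC A *ᵥ x + toC B *ᵥ u)) ⬝ᵥ u).re
      - (star x ⬝ᵥ (toC P *ᵥ (toC A *ᵥ x + toC B *ᵥ u))).re)
    intro t
    -- The slack along this line is a nonnegative polynomial in t without constant term, so its
    -- linear coefficient is zero.
    have h1 := h.complex (v + (t : ℂ) • x) ((t : ℂ) • u)
    have h2 : (star x ⬝ᵥ (toC P *ᵥ (toC A *ᵥ v))).re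
        = (star (toC A *ᵥ v) ⬝ᵥ (toC P *ᵥ x)).re := by
      rw [← star_dotProduct_symm hP]; simp
    simp only [Matrix.mulVec_add, Matrix.mulVec_smul, star_add, star_smul, add_dotProduct,
      dotProduct_add, smul_dotProduct, dotProduct_smul, smul_eq_mul, Complex.add_re,
      Complex.star_def, Complex.conj_ofReal, Complex.re_ofReal_mul, Complex.sub_re] at h1 hv h2 ⊢
    rw [h2, hv] at h1
    linarith
  have h1 := key x u
  -- Rotating the direction by i turns the real-part identity into the imaginary-part one.
  have h2 := key (Complex.I • x) (Complex.I • u)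
  simp only [Matrix.mulVec_add, Matrix.mulVec_smul,
      dotProduct_add, dotProduct_smul, smul_eq_mul, Complex.add_re,
      Complex.sub_re, Complex.I_mul_re] at h1 h2 ⊢
  apply Complex.ext
  · simp only [Complex.add_re]; linarith
  · simp only [Complex.add_im]; linarith

end NegImag

/-! ### Trajectories, controllability and observability -/

namespace NegImag

variable {n m : ℕ} {A : Matrix (Fin n) (Fin n) ℝ} {B : Matrix (Fin n) (Fin m) ℝ}
  {C : Matrix (Fin m) (Fin n) ℝ} {P : Matrix (Fin n) (Fin n) ℝ}

lemma hasDerivWithinAt_mulVec {k l : Type*} [Fintype k] [Fintype l] (M : Matrix k l ℝ)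
    {x : ℝ → l → ℝ} {x' : l → ℝ} {s : Set ℝ} {t : ℝ} (h : HasDerivWithinAt x x' s t) :
    HasDerivWithinAt (fun τ => M *ᵥ x τ) (M *ᵥ x') s t :=
  (M.mulVecLin.toContinuousLinearMap.hasFDerivAt (x := x t)).comp_hasDerivWithinAt t h

lemma hasDerivWithinAt_storage (hP : P.IsSymm) {x : ℝ → Fin n → ℝ} {x' : Fin n → ℝ}
    {s : Set ℝ} {t : ℝ} (h : HasDerivWithinAt x x' s t) :
    HasDerivWithinAt (fun τ => storage P (x τ)) (x t ⬝ᵥ (P *ᵥ x')) s t := by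
  have h1 := hasDerivWithinAt_mulVec P h
  have h2 : HasDerivWithinAt (fun τ => x τ ⬝ᵥ (P *ᵥ x τ))
      (∑ i, (x' i * (P *ᵥ x t) i + x t i * (P *ᵥ x') i)) s t := by
    unfold dotProduct
    exact HasDerivWithinAt.fun_sum fun i _ =>
      ((hasDerivWithinAt_pi.1 h i).mul (hasDerivWithinAt_pi.1 h1 i))
  have h3 : ∑ i, (x' i * (P *ᵥ x t) i + x t i * (P *ᵥ x') i) = 2 * (x t ⬝ᵥ (P *ᵥ x')) := by
    rw [Finset.sum_add_distrib]
    change x' ⬝ᵥ (P *ᵥ x t) + x t ⬝ᵥ (P *ᵥ x') = _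
    rw [Matrix.dotProduct_mulVec, ← Matrix.mulVec_transpose, hP.eq, dotProduct_comm]
    ring
  rw [h3] at h2
  exact (h2.const_mul (1 / 2)).congr_deriv (by ring)

/-- Adjoining u' = 0 makes the system autonomous, so a matrix exponential solves it. -/
lemma exists_trajectory_const (A : Matrix (Fin n) (Fin n) ℝ) (B : Matrix (Fin n) (Fin m) ℝ)
    (x₀ : Fin n → ℝ) (u₀ : Fin m → ℝ) :
    ∃ x : ℝ → Fin n → ℝ, IsTrajectory A B (fun _ => u₀) x ∧ x 0 = x₀ := by
  let T : ((Fin n → ℝ) × (Fin m → ℝ)) →L[ℝ] ((Fin n → ℝ) × (Fin m → ℝ)) :=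
    LinearMap.toContinuousLinearMap
      ((A.mulVecLin.comp (LinearMap.fst ℝ _ _) + B.mulVecLin.comp (LinearMap.snd ℝ _ _)).prod 0)
  have hT : ∀ z, T z = (A *ᵥ z.1 + B *ᵥ z.2, 0) := fun z => rfl
  let z : ℝ → (Fin n → ℝ) × (Fin m → ℝ) := fun t => NormedSpace.exp (t • T) (x₀, u₀)
  have hz : ∀ t, HasDerivAt z (T (z t)) t := by
    intro t
    have h1 := hasDerivAt_exp_smul_const' (𝕂 := ℝ) T t
    exact h1.clm_apply (hasDerivAt_const t (x₀, u₀)) |>.congr_deriv (by simp [z])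
  have hz0 : z 0 = (x₀, u₀) := by simp [z]
  have hz2 : ∀ t, (z t).2 = u₀ := by
    intro t
    have h1 : ∀ s, HasDerivAt (fun s => (z s).2) 0 s := fun s => by
      have := (hz s).snd
      rwa [hT] at this
    have := is_const_of_deriv_eq_zero (fun s => (h1 s).differentiableAt) (fun s => (h1 s).deriv)
      t 0
    rw [this, hz0]
  refine ⟨fun t => (z t).1, ⟨continuousOn_const, fun t _ => ?_⟩, by simp only [hz0]⟩
  have := (ContinuousLinearMap.fst ℝ (Fin n → ℝ) (Fin m → ℝ)).hasFDerivAt.comp_hasDerivAt t (hz t)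
  rw [hT, hz2] at this
  exact this.hasDerivWithinAt

lemma dissipative_iff (hP : P.IsSymm) :
    Dissipative A B C (storage P) ↔ StorageInequality A B C P := by
  constructor
  · intro h x₀ u₀
    obtain ⟨x, hx, hx0⟩ := exists_trajectory_const A B x₀ u₀
    obtain ⟨V', y', h1, h2, h3⟩ := h _ x hx 0 le_rfl
    have hd := hx.state_eq 0 le_rfl
    have hu : UniqueDiffWithinAt ℝ (Set.Ici (0 : ℝ)) 0 := uniqueDiffOn_Ici 0 0 Set.self_mem_Ici
    rw [hu.eq_deriv _ h1 (hasDerivWithinAt_storage hP hd),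
      hu.eq_deriv _ h2 (hasDerivWithinAt_mulVec C hd), hx0] at h3
    exact h3
  · intro h u x hx t ht
    have hd := hx.state_eq t ht
    exact ⟨_, _, hasDerivWithinAt_storage hP hd, hasDerivWithinAt_mulVec C hd, h _ _⟩

/-- The storage function that is monotone along all trajectories of a controllable system
vanishes. -/
lemma Controllable.eq_zero_of_monotone (hc : Controllable A B) (hP : P.IsSymm)
    (h : ∀ x u, 0 ≤ x ⬝ᵥ (P *ᵥ (A *ᵥ x + B *ᵥ u))) : P = 0 := by
  have hV : ∀ x₀ x₁, storage P x₀ ≤ storage P x₁ := by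
    intro x₀ x₁
    obtain ⟨u, x, T, hx, hT, rfl, rfl⟩ := hc x₀ x₁
    have hd : ∀ t, 0 ≤ t → HasDerivWithinAt (fun τ => storage P (x τ)) _ (Set.Ici 0) t :=
      fun t ht => hasDerivWithinAt_storage hP (hx.state_eq t ht)
    have hm : MonotoneOn (fun τ => storage P (x τ)) (Set.Ici 0) := by
      refine monotoneOn_of_hasDerivWithinAt_nonneg (convex_Ici 0)
        (fun t ht => (hd t ht).continuousWithinAt)
        (fun t ht => (hd t (interior_subset ht)).mono interior_subset) ?_
      intro t _
      exact h _ _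
    exact hm Set.self_mem_Ici hT hT
  have h0 : ∀ x, storage P x = 0 := fun x => by
    have := le_antisymm (hV x 0) (hV 0 x)
    -- The comparison is with the state 0, where the storage is zero; polarization then recovers the
    -- entries of P.
    simpa [storage] using this
  ext i j
  have h1 := h0 (Pi.single i 1 + Pi.single j 1)
  have h2 := h0 (Pi.single i 1)
  have h3 := h0 (Pi.single j 1)
  have h4 : P i j = P j i := hP.apply j i
  simp [storage, Matrix.mulVec_add] at h1 h2 h3
  simp only [Matrix.zero_apply]
  linarith

/-- If W were proper, its annihilator would contain a left eigenvector φ of A with φB = 0. Then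
exp(-μt) φ(x(t)) is constant along trajectories, so φ vanishes on every state reachable from 0,
hence everywhere. -/
lemma Controllable.eq_top (hc : Controllable A B) {W : Submodule ℂ (Fin n → ℂ)}
    (hA : ∀ w ∈ W, toC A *ᵥ w ∈ W) (hB : ∀ u, toC B *ᵥ u ∈ W) : W = ⊤ := by
  by_contra hW
  let D : Submodule ℂ (Module.Dual ℂ (Fin n → ℂ)) := W.dualAnnihilator
  have hD : D ≠ ⊥ := by
    intro h
    exact hW (by simpa [D] using h)
  have hnt : Nontrivial D := Submodule.nontrivial_iff_ne_bot.2 hD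
  let T : D →ₗ[ℂ] D := ((toC A).mulVecLin.dualMap).restrict (p := D) (q := D) (by
    intro φ hφ
    rw [Submodule.mem_dualAnnihilator] at hφ ⊢
    intro w hw
    exact hφ _ (hA w hw))
  obtain ⟨μ, hμ⟩ := Module.End.exists_eigenvalue T
  obtain ⟨φ, hφ⟩ := hμ.exists_hasEigenvector
  have h1 : ∀ w, φ.1 (toC A *ᵥ w) = μ * φ.1 w := by
    intro w
    exact congrArg (fun ψ : D => ψ.1 w) hφ.apply_eq_smul
  have h2 : ∀ u, φ.1 (toC B *ᵥ u) = 0 := fun u => (Submodule.mem_dualAnnihilator _).1 φ.2 _ (hB u)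
  have h3 : ∀ x₁ : Fin n → ℝ, φ.1 (vecC x₁) = 0 := by
    intro x₁
    obtain ⟨u, x, T, hx, hT, hx0, rfl⟩ := hc 0 x₁
    let ψ : (Fin n → ℝ) →L[ℝ] ℂ := LinearMap.toContinuousLinearMap
      { toFun := fun x => φ.1 (vecC x)
        map_add' := fun x y => by rw [← map_add]; congr 1; ext; simp [vecC]
        map_smul' := fun c x => by
          rw [RingHom.id_apply, Complex.real_smul, ← smul_eq_mul, ← map_smul]
          congr 1; ext; simp [vecC] }
    have hψ : ∀ x, ψ x = φ.1 (vecC x) := fun _ => rfl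
    have hd : ∀ t, 0 ≤ t → HasDerivWithinAt
        (fun τ : ℝ => Complex.exp (-(μ * τ)) * ψ (x τ)) 0 (Set.Ici 0) t := by
      intro t ht
      have e1 : HasDerivWithinAt (fun τ : ℝ => Complex.exp (-(μ * τ)))
          (Complex.exp (-(μ * t)) * (-(μ * 1))) (Set.Ici 0) t :=
        ((((hasDerivAt_id (t : ℂ)).comp_ofReal).const_mul μ).neg.cexp).hasDerivWithinAt
      have e2 : HasDerivWithinAt (fun τ => ψ (x τ)) (ψ (A *ᵥ x t + B *ᵥ u t)) (Set.Ici 0) t :=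
        (ψ.hasFDerivAt (x := x t)).comp_hasDerivWithinAt t (hx.state_eq t ht)
      refine (e1.mul e2).congr_deriv ?_
      rw [map_add, hψ (A *ᵥ _), hψ (B *ᵥ _), ← toC_mulVec_vecC, ← toC_mulVec_vecC, h1, h2, hψ]
      ring
    have hconst := (convex_Ici (0 : ℝ)).is_const_of_fderivWithin_eq_zero (𝕜 := ℝ)
      (f := fun τ : ℝ => Complex.exp (-(μ * τ)) * ψ (x τ))
      (fun t ht => (hd t ht).differentiableWithinAt)
      (fun t ht => by
        have := (hd t ht).hasFDerivWithinAt.fderivWithin (uniqueDiffOn_Ici 0 t ht)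
        rw [this]; ext; simp) (x := 0) (y := T) Set.self_mem_Ici hT
    simp only [hx0, map_zero, mul_zero] at hconst
    have := hconst.symm
    rcases mul_eq_zero.1 this with h | h
    · exact absurd h (Complex.exp_ne_zero _)
    · exact h
  apply hφ.2
  ext i
  have := h3 (Pi.single i 1)
  have e : vecC (Pi.single i 1 : Fin n → ℝ) = Pi.single i 1 := by
    ext j; by_cases hj : j = i
    · subst hj; simp [vecC]
    · simp [vecC, hj]
  rw [e] at this
  simpa using this

/-- A controllable pair admits a continuous right inverse of `[-(s - A), B]` for all `s`. -/
lemma Controllable.exists_rightInverse (hc : Controllable A B) (y : Fin n → ℂ) :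
    ∃ (x : ℂ → Fin n → ℂ) (u : ℂ → Fin m → ℂ), Continuous x ∧ Continuous u ∧
      ∀ s, toC B *ᵥ u s - (s • x s - toC A *ᵥ x s) = y := by
  let W : Submodule ℂ (Fin n → ℂ) :=
    { carrier := {y | ∃ (x : ℂ → Fin n → ℂ) (u : ℂ → Fin m → ℂ), Continuous x ∧ Continuous u ∧
        ∀ s, toC B *ᵥ u s - (s • x s - toC A *ᵥ x s) = y}
      zero_mem' := ⟨fun _ => 0, fun _ => 0, continuous_const, continuous_const, by simp⟩
      add_mem' := by
        rintro y y' ⟨x, u, hx, hu, h⟩ ⟨x', u', hx', hu', h'⟩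
        refine ⟨fun s => x s + x' s, fun s => u s + u' s, hx.add hx', hu.add hu', fun s => ?_⟩
        rw [← h s, ← h' s, Matrix.mulVec_add, Matrix.mulVec_add, smul_add]
        abel
      smul_mem' := by
        rintro c y ⟨x, u, hx, hu, h⟩
        refine ⟨fun s => c • x s, fun s => c • u s, hx.const_smul c, hu.const_smul c, fun s => ?_⟩
        rw [← h s, Matrix.mulVec_smul, Matrix.mulVec_smul, smul_sub, smul_sub, smul_comm s c] }
  have hW : W = ⊤ := by
    apply hc.eq_top
    · rintro y ⟨x, u, hx, hu, h⟩
      -- If Bu - (s - A)x = y, then Bsu - (s - A)(sx + y) = sy - (s - A)y = Ay.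
      refine ⟨fun s => s • x s + y, fun s => s • u s, (continuous_id.smul hx).add continuous_const,
        continuous_id.smul hu, fun s => ?_⟩
      have h1 := h s
      rw [Matrix.mulVec_add, Matrix.mulVec_smul, Matrix.mulVec_smul, smul_add]
      nth_rewrite 1 [← h1]
      rw [smul_sub, smul_sub]
      abel
    · intro u
      exact ⟨fun _ => 0, fun _ => u, continuous_const, continuous_const, by simp⟩
  have : y ∈ W := hW ▸ Submodule.mem_top
  exact this

/-- Eigenvectors of an observable system are not annihilated by the output matrix. -/
lemma Observable.eq_zero (ho : Observable A B C) {μ : ℂ} {v : Fin n → ℂ}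
    (hA : toC A *ᵥ v = μ • v) (hC : toC C *ᵥ v = 0) : v = 0 := by
  have key : ∀ v : Fin n → ℂ, toC A *ᵥ v = μ • v → toC C *ᵥ v = 0 → reV v = 0 := by
    intro v hA hC
    -- A free motion with zero output, hence indistinguishable from rest.
    let x : ℝ → Fin n → ℝ := fun t => reV (Complex.exp (μ * t) • v)
    have hx : IsTrajectory A B (fun _ => 0) x := by
      refine ⟨continuousOn_const, fun t _ => ?_⟩
      rw [Matrix.mulVec_zero, add_zero]
      have e1 : HasDerivAt (fun τ : ℝ => Complex.exp (μ * τ))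
          (Complex.exp (μ * t) * (μ * 1)) t :=
        (((hasDerivAt_id (t : ℂ)).comp_ofReal).const_mul μ).cexp
      rw [hasDerivWithinAt_pi]
      intro i
      have e2 := (e1.mul_const (v i))
      have e3 := (Complex.reCLM.hasFDerivAt.comp_hasDerivAt t e2).hasDerivWithinAt
        (s := Set.Ici 0)
      refine e3.congr_deriv ?_
      rw [← reV_toC_mulVec, Matrix.mulVec_smul, hA]
      simp only [reV, Pi.smul_apply, smul_eq_mul, Complex.reCLM_apply]
      congr 1; ring
    have h0 : IsTrajectory A B (fun _ => 0) (fun _ => 0) :=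
      ⟨continuousOn_const, fun t _ => by simpa using hasDerivWithinAt_const t _ (0 : Fin n → ℝ)⟩
    have := ho _ _ _ hx h0 (fun t _ => by
      simp only [x]
      rw [← reV_toC_mulVec, Matrix.mulVec_smul, hC]
      ext; simp [reV])
    simpa [x] using this
  apply eq_zero_of_reV_imV (key v hA hC)
  have := key (-Complex.I • v) (by rw [Matrix.mulVec_smul, hA, smul_comm])
    (by rw [Matrix.mulVec_smul, hC, smul_zero])
  ext i
  have := congrFun this i
  simpa [reV, imV] using this

end NegImag

/-! ### The transfer function, its values and its poles -/

namespace NegImag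

variable {n m : ℕ} {A : Matrix (Fin n) (Fin n) ℝ} {B : Matrix (Fin n) (Fin m) ℝ}
  {C : Matrix (Fin m) (Fin n) ℝ} {P : Matrix (Fin n) (Fin n) ℝ}

/-- The numerator of the transfer function over the characteristic polynomial of `A`. -/
noncomputable def numerator (A : Matrix (Fin n) (Fin n) ℝ) (B : Matrix (Fin n) (Fin m) ℝ)
    (C : Matrix (Fin m) (Fin n) ℝ) : Matrix (Fin m) (Fin m) (Polynomial ℝ) :=
  C.map Polynomial.C * (Matrix.charmatrix A).adjugate * B.map Polynomial.C

lemma transferFunction_apply (i j : Fin m) :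
    transferFunction A B C i j =
      algebraMap (Polynomial ℝ) (RatFunc ℝ) (numerator A B C i j) /
        algebraMap (Polynomial ℝ) (RatFunc ℝ) A.charpoly := by
  let φ := algebraMap (Polynomial ℝ) (RatFunc ℝ)
  have h1 : Matrix.scalar (Fin n) RatFunc.X - A.map RatFunc.C
      = (Matrix.charmatrix A).map φ := by
    ext i j
    by_cases h : i = j
    · subst h; simp [φ]
    · simp [h, φ]
  have h2 : (Matrix.charmatrix A).map φ = φ.mapMatrix (Matrix.charmatrix A) := rfl
  have hC : C.map RatFunc.C = (C.map Polynomial.C).map φ := by ext; simp [φ]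
  have hB : B.map RatFunc.C = (B.map Polynomial.C).map φ := by ext; simp [φ]
  have h3 : transferFunction A B C = (φ A.charpoly)⁻¹ • (numerator A B C).map φ := by
    rw [transferFunction, h1, Matrix.inv_def, h2, ← RingHom.map_det, ← RingHom.map_adjugate,
      hC, hB, numerator, Matrix.map_mul, Matrix.map_mul, Ring.inverse_eq_inv',
      Matrix.mul_smul, Matrix.smul_mul]
    rfl
  rw [h3, Matrix.smul_apply, Matrix.map_apply, smul_eq_mul, div_eq_inv_mul]

lemma eval₂_charpoly (A : Matrix (Fin n) (Fin n) ℝ) (s : ℂ) :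
    A.charpoly.eval₂ (algebraMap ℝ ℂ) s = (Matrix.scalar (Fin n) s - toC A).det := by
  rw [← Matrix.eval_charpoly, ← Polynomial.eval_map, ← Matrix.charpoly_map]
  rfl

lemma eval₂_charpoly_eq_zero_iff {s : ℂ} :
    A.charpoly.eval₂ (algebraMap ℝ ℂ) s = 0 ↔ ∃ v ≠ 0, toC A *ᵥ v = s • v := by
  rw [eval₂_charpoly, ← Matrix.exists_mulVec_eq_zero_iff]
  refine exists_congr fun v => and_congr_right fun _ => ?_
  rw [Matrix.sub_mulVec, sub_eq_zero, eq_comm, Matrix.scalar_apply, Matrix.diagonal_const_mulVec]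

lemma eval₂_denom_ne_zero {s : ℂ} (hs : A.charpoly.eval₂ (algebraMap ℝ ℂ) s ≠ 0)
    (i j : Fin m) : (transferFunction A B C i j).denom.eval₂ (algebraMap ℝ ℂ) s ≠ 0 := by
  intro h
  apply hs
  refine Polynomial.eval₂_eq_zero_of_dvd_of_eval₂_eq_zero _ _ ?_ h
  rw [transferFunction_apply]
  exact RatFunc.denom_div_dvd _ _

/-- `RatFunc.eval` uses the reduced fraction, whereas `numerator` over the characteristic polynomial
may have common factors; cross-multiplying compares the two. -/
lemma evalAt_apply {s : ℂ} (hs : A.charpoly.eval₂ (algebraMap ℝ ℂ) s ≠ 0) (i j : Fin m) :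
    evalAt (transferFunction A B C) s i j =
      (numerator A B C i j).eval₂ (algebraMap ℝ ℂ) s / A.charpoly.eval₂ (algebraMap ℝ ℂ) s := by
  have h0 : A.charpoly ≠ 0 := A.charpoly_monic.ne_zero
  have h1 := (RatFunc.num_mul_eq_mul_denom_iff h0).2 (transferFunction_apply (A := A) (B := B)
    (C := C) i j)
  have h2 := congrArg (Polynomial.eval₂ (algebraMap ℝ ℂ) s) h1
  rw [Polynomial.eval₂_mul, Polynomial.eval₂_mul] at h2
  rw [evalAt, Matrix.of_apply, RatFunc.eval, div_eq_div_iff (eval₂_denom_ne_zero hs i j) hs, h2]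

/-- The transfer function maps `u` to `C x` where `(s - A) x = B u`. -/
lemma evalAt_mulVec {s : ℂ} (hs : A.charpoly.eval₂ (algebraMap ℝ ℂ) s ≠ 0)
    {x : Fin n → ℂ} {u : Fin m → ℂ} (h : s • x - toC A *ᵥ x = toC B *ᵥ u) :
    evalAt (transferFunction A B C) s *ᵥ u = toC C *ᵥ x := by
  let φ := Polynomial.eval₂RingHom (algebraMap ℝ ℂ) s
  have h1 : (numerator A B C).map φ
      = toC C * (Matrix.scalar (Fin n) s - toC A).adjugate * toC B := by
    have e1 : φ.mapMatrix (Matrix.charmatrix A) = Matrix.scalar (Fin n) s - toC A := by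
      ext i j
      by_cases h : i = j
      · subst h; simp [φ]
      · simp [h, φ]
    have hC : (C.map Polynomial.C).map φ = toC C := by ext; simp [φ]
    have hB : (B.map Polynomial.C).map φ = toC B := by ext; simp [φ]
    rw [numerator, Matrix.map_mul, Matrix.map_mul, hC, hB, ← e1, ← RingHom.map_adjugate]
    rfl
  have h2 : evalAt (transferFunction A B C) s
      = (A.charpoly.eval₂ (algebraMap ℝ ℂ) s)⁻¹ • (numerator A B C).map φ := by
    ext i j
    rw [evalAt_apply hs, Matrix.smul_apply, Matrix.map_apply, smul_eq_mul, div_eq_inv_mul]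
    rfl
  have h3 : toC B *ᵥ u = (Matrix.scalar (Fin n) s - toC A) *ᵥ x := by
    rw [← h, Matrix.sub_mulVec, Matrix.scalar_apply, Matrix.diagonal_const_mulVec]
  rw [h2, h1, Matrix.smul_mulVec, ← Matrix.mulVec_mulVec, h3, ← Matrix.mulVec_mulVec,
    Matrix.mulVec_mulVec _ (Matrix.adjugate _), Matrix.adjugate_mul, Matrix.smul_mulVec,
    Matrix.one_mulVec, Matrix.mulVec_smul, smul_smul, ← eval₂_charpoly, inv_mul_cancel₀ hs,
    one_smul]

lemma exists_resolvent {s : ℂ} (hs : A.charpoly.eval₂ (algebraMap ℝ ℂ) s ≠ 0)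
    (y : Fin n → ℂ) : ∃ x, s • x - toC A *ᵥ x = y := by
  rw [eval₂_charpoly] at hs
  refine ⟨(Matrix.scalar (Fin n) s - toC A)⁻¹ *ᵥ y, ?_⟩
  have : ∀ x, s • x - toC A *ᵥ x = (Matrix.scalar (Fin n) s - toC A) *ᵥ x := fun x => by
    rw [Matrix.sub_mulVec, Matrix.scalar_apply, Matrix.diagonal_const_mulVec]
  rw [this, Matrix.mulVec_mulVec, Matrix.mul_nonsing_inv _ (isUnit_iff_ne_zero.2 hs),
    Matrix.one_mulVec]

lemma finite_charpoly_zeros (A : Matrix (Fin n) (Fin n) ℝ) :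
    {s : ℂ | A.charpoly.eval₂ (algebraMap ℝ ℂ) s = 0}.Finite := by
  have h0 : A.charpoly.map (algebraMap ℝ ℂ) ≠ 0 := (A.charpoly_monic.map _).ne_zero
  refine (Polynomial.finite_setOfPred_isRoot h0).subset fun s hs => ?_
  rw [Set.mem_ofPred_eq, Polynomial.IsRoot, Polynomial.eval_map]
  exact hs

lemma eventually_charpoly_ne_zero (A : Matrix (Fin n) (Fin n) ℝ) (c : ℂ) :
    ∀ᶠ s in 𝓝[≠] c, A.charpoly.eval₂ (algebraMap ℝ ℂ) s ≠ 0 := by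
  have h := (finite_charpoly_zeros A).subset (Set.sdiff_subset (t := {c}))
  have h1 := h.isClosed.isOpen_compl.mem_nhds (x := c) (by simp)
  filter_upwards [nhdsWithin_le_nhds h1, self_mem_nhdsWithin] with s hs1 hs2 hs3
  exact hs1 ⟨hs3, hs2⟩

lemma tendsto_mulVec {ι k l : Type*} [Fintype l] {f : Filter ι} {M : ι → Matrix k l ℂ}
    {v : ι → l → ℂ} {M₀ : Matrix k l ℂ} {v₀ : l → ℂ} (hM : Filter.Tendsto M f (𝓝 M₀))
    (hv : Filter.Tendsto v f (𝓝 v₀)) :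
    Filter.Tendsto (fun i => M i *ᵥ v i) f (𝓝 (M₀ *ᵥ v₀)) := by
  have hm : Continuous fun p : Matrix k l ℂ × (l → ℂ) => p.1 *ᵥ p.2 :=
    continuous_fst.matrix_mulVec continuous_snd
  exact Filter.Tendsto.comp (g := fun p : Matrix k l ℂ × (l → ℂ) => p.1 *ᵥ p.2)
    (f := fun i => (M i, v i)) (hm.tendsto (M₀, v₀)) (hM.prodMk_nhds hv)

/-- The residue of the transfer function at an eigenvalue of `A` determines the output of the
eigenvectors. -/
lemma output_eq_residue {c : ℂ} {v : Fin n → ℂ} (hv : toC A *ᵥ v = c • v)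
    {L : Matrix (Fin m) (Fin m) ℂ}
    (hL : Filter.Tendsto (fun s : ℂ => (s - c) • evalAt (transferFunction A B C) s)
      (𝓝[≠] c) (𝓝 L))
    {x : ℂ → Fin n → ℂ} {u : ℂ → Fin m → ℂ} (hx : Continuous x) (hu : Continuous u)
    (h : ∀ s, toC B *ᵥ u s - (s • x s - toC A *ᵥ x s) = v) :
    toC C *ᵥ v = L *ᵥ u c := by
  have h1 : Filter.Tendsto
      (fun s => ((s - c) • evalAt (transferFunction A B C) s) *ᵥ u s) (𝓝[≠] c)
      (𝓝 (L *ᵥ u c)) := by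
    exact tendsto_mulVec hL ((hu.tendsto c).mono_left nhdsWithin_le_nhds)
  have h2 : Filter.Tendsto (fun s => toC C *ᵥ (v + (s - c) • x s)) (𝓝[≠] c)
      (𝓝 (toC C *ᵥ v)) := by
    have hm : Continuous fun s : ℂ => toC C *ᵥ (v + (s - c) • x s) := by fun_prop
    have := hm.tendsto c
    simp only [sub_self, zero_smul, add_zero] at this
    exact this.mono_left nhdsWithin_le_nhds
  refine tendsto_nhds_unique (h2.congr' ?_) h1
  filter_upwards [eventually_charpoly_ne_zero A c, self_mem_nhdsWithin] with s hs hsc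
  have hsc' : s - c ≠ 0 := sub_ne_zero.2 hsc
  -- Since (s - A)v = (s - c)v, adding v / (s - c) to x yields the exact state response to u; its
  -- singular part is visible.
  have h3 : s • ((s - c)⁻¹ • v + x s) - toC A *ᵥ ((s - c)⁻¹ • v + x s) = toC B *ᵥ u s := by
    rw [sub_eq_iff_eq_add.1 (h s), Matrix.mulVec_add, Matrix.mulVec_smul, hv, smul_add]
    have : s • (s - c)⁻¹ • v - (s - c)⁻¹ • c • v = v := by
      rw [smul_smul, smul_smul, ← sub_smul, mul_comm, ← mul_sub, inv_mul_cancel₀ hsc', one_smul]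
    rw [add_sub_add_comm, this]
  rw [Matrix.smul_mulVec, evalAt_mulVec hs h3, ← Matrix.mulVec_smul, smul_add, smul_smul,
    mul_inv_cancel₀ hsc', one_smul]

lemma continuousAt_evalAt {G : Matrix (Fin m) (Fin m) (RatFunc ℝ)} {c : ℂ} (hc : ¬ IsPole G c) :
    ContinuousAt (evalAt G) c := by
  refine tendsto_pi_nhds.2 fun i => tendsto_pi_nhds.2 fun j => ?_
  have hd : (G i j).denom.eval₂ (algebraMap ℝ ℂ) c ≠ 0 := fun h => hc ⟨i, j, h⟩
  have h1 : ∀ p : Polynomial ℝ, Continuous fun s : ℂ => p.eval₂ (algebraMap ℝ ℂ) s := by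
    intro p
    simp only [← Polynomial.eval_map]
    exact Polynomial.continuous _
  exact ((h1 _).tendsto c).div ((h1 _).tendsto c) hd

/-- The poles of the transfer function of a minimal realization are the eigenvalues of `A`. -/
lemma isPole_iff (hc : Controllable A B) (ho : Observable A B C) {s : ℂ} :
    IsPole (transferFunction A B C) s ↔ ∃ v ≠ 0, toC A *ᵥ v = s • v := by
  rw [← eval₂_charpoly_eq_zero_iff]
  constructor
  · rintro ⟨i, j, h⟩
    by_contra hs
    exact eval₂_denom_ne_zero hs i j h
  · intro hs
    by_contra hp
    obtain ⟨v, hv0, hv⟩ := eval₂_charpoly_eq_zero_iff.1 hs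
    obtain ⟨x, u, hx, hu, h⟩ := hc.exists_rightInverse v
    apply hv0
    apply ho.eq_zero hv
    -- At an eigenvalue that is not a pole the residue is zero, so Cv = 0, against observability.
    have hL : Filter.Tendsto (fun z : ℂ => (z - s) • evalAt (transferFunction A B C) z)
        (𝓝[≠] s) (𝓝 0) := by
      have h1 : ContinuousAt (fun z : ℂ => (z - s) • evalAt (transferFunction A B C) z) s :=
        (continuousAt_id.sub continuousAt_const).smul (continuousAt_evalAt hp)
      have h2 := h1.tendsto
      simp only [sub_self, zero_smul] at h2
      exact h2.mono_left nhdsWithin_le_nhds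
    rw [output_eq_residue hv hL hx hu h, Matrix.zero_mulVec]

end NegImag

/-! ### From a storage function to the negative imaginary property -/

namespace NegImag

variable {n m : ℕ} {A : Matrix (Fin n) (Fin n) ℝ} {B : Matrix (Fin n) (Fin m) ℝ}
  {C : Matrix (Fin m) (Fin n) ℝ} {P : Matrix (Fin n) (Fin n) ℝ}

/-- The (real) value at `x` of the Hermitian form of `P`. -/
noncomputable def energy (P : Matrix (Fin n) (Fin n) ℝ) (x : Fin n → ℂ) : ℝ :=
  (star x ⬝ᵥ (toC P *ᵥ x)).re

lemma star_dotProduct_self (hP : P.IsSymm) (x : Fin n → ℂ) :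
    star x ⬝ᵥ (toC P *ᵥ x) = (energy P x : ℂ) := by
  have h := star_dotProduct_symm hP x x
  exact (Complex.conj_eq_iff_re.1 h).symm

lemma energy_eq (P : Matrix (Fin n) (Fin n) ℝ) (x : Fin n → ℂ) :
    energy P x = reV x ⬝ᵥ (P *ᵥ reV x) + imV x ⬝ᵥ (P *ᵥ imV x) := by
  rw [energy, re_star_dotProduct, reV_toC_mulVec, imV_toC_mulVec]

lemma energy_pos (hP : P.PosDef) {x : Fin n → ℂ} (hx : x ≠ 0) : 0 < energy P x := by
  have h : ∀ y : Fin n → ℝ, y ≠ 0 → 0 < y ⬝ᵥ (P *ᵥ y) := fun y hy => by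
    simpa using hP.dotProduct_mulVec_pos hy
  have h0 : ∀ y : Fin n → ℝ, 0 ≤ y ⬝ᵥ (P *ᵥ y) := fun y => by
    by_cases hy : y = 0
    · simp [hy]
    · exact (h y hy).le
  rw [energy_eq]
  by_cases h1 : reV x = 0
  · have h2 : imV x ≠ 0 := fun h2 => hx (eq_zero_of_reV_imV h1 h2)
    exact add_pos_of_nonneg_of_pos (h0 _) (h _ h2)
  · exact add_pos_of_pos_of_nonneg (h _ h1) (h0 _)

lemma energy_nonneg (hP : P.PosDef) (x : Fin n → ℂ) : 0 ≤ energy P x := by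
  by_cases hx : x = 0
  · simp [hx, energy]
  · exact (energy_pos hP hx).le

lemma isSymm_of_posDef (hP : P.PosDef) : P.IsSymm := by
  have := hP.isHermitian
  rwa [Matrix.IsHermitian, Matrix.conjTranspose_eq_transpose_of_trivial] at this

/-- Young's inequality for the Hermitian form of a positive definite matrix. -/
lemma norm_form_le (hP : P.PosDef) (g x : Fin n → ℂ) :
    2 * ‖star g ⬝ᵥ (toC P *ᵥ x)‖ ≤ energy P g + energy P x := by
  -- The phase c makes the cross term real, so the energy of cx - g gives the bound.
  obtain ⟨c, hc, hw⟩ := RCLike.exists_norm_eq_mul_self (star g ⬝ᵥ (toC P *ᵥ x))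
  have hs := isSymm_of_posDef hP
  have h := energy_nonneg hP (c • x - g)
  have hcc : star c * c = 1 := by
    rw [Complex.star_def, Complex.conj_mul', hc]; simp
  have h1 := congrArg Complex.re hw
  have h2 := congrArg Complex.re (star_dotProduct_symm hs g (c • x))
  simp only [energy, Matrix.mulVec_sub, Matrix.mulVec_smul, star_sub, star_smul, sub_dotProduct,
    dotProduct_sub, smul_dotProduct, dotProduct_smul, smul_eq_mul] at h h2 ⊢
  have e : c * (star c * (star x ⬝ᵥ (toC P *ᵥ x)) - star g ⬝ᵥ (toC P *ᵥ x))
      = star x ⬝ᵥ (toC P *ᵥ x) - c * (star g ⬝ᵥ (toC P *ᵥ x)) := by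
    linear_combination (star x ⬝ᵥ (toC P *ᵥ x)) * hcc
  rw [e] at h
  simp only [Complex.sub_re] at h
  rw [Complex.star_def, Complex.conj_re] at h2
  rw [Complex.star_def] at h
  simp only [RCLike.ofReal_eq_complex_ofReal, Complex.ofReal_re] at h1
  linarith

/-- The dissipation inequality on exponential trajectories. -/
lemma StorageInequality.passive (h : StorageInequality A B C P) (hP : P.IsSymm) {s : ℂ}
    {x : Fin n → ℂ} {u : Fin m → ℂ} (hx : s • x - toC A *ᵥ x = toC B *ᵥ u) :
    s.re * energy P x ≤ (s * (star u ⬝ᵥ (toC C *ᵥ x))).re := by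
  have h1 := h.complex x u
  rw [← hx, add_sub_cancel, Matrix.mulVec_smul, Matrix.mulVec_smul, dotProduct_smul,
    star_dotProduct_self hP, star_smul, smul_dotProduct, smul_eq_mul, smul_eq_mul,
    Complex.re_mul_ofReal, ← star_star_dotProduct u, Complex.star_def, ← map_mul,
    Complex.conj_re] at h1
  exact h1

lemma posSemidef_of_nonneg {K : Matrix (Fin m) (Fin m) ℂ}
    (h : ∀ u : Fin m → ℂ, 0 ≤ star u ⬝ᵥ (K *ᵥ u)) : K.PosSemidef := by
  rw [← Matrix.isPositive_toEuclideanLin_iff, LinearMap.isPositive_iff_complex]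
  intro x
  have h1 := h (WithLp.ofLp x)
  have h2 : inner ℂ (K.toEuclideanLin x) x = star (star (WithLp.ofLp x) ⬝ᵥ (K *ᵥ WithLp.ofLp x)) := by
    rw [EuclideanSpace.inner_eq_star_dotProduct, star_star_dotProduct, dotProduct_comm]
    rfl
  rw [Complex.nonneg_iff] at h1
  rw [h2]
  refine ⟨?_, ?_⟩
  · apply Complex.ext
    · simp
    · simp [← h1.2]
  · simpa using h1.1

/-- This identifies the second condition with Re(iω u*Gu) ≥ 0, the form that
`StorageInequality.passive` delivers. -/
lemma form_smul_sub_conjTranspose (G : Matrix (Fin m) (Fin m) ℂ) (ω : ℝ) (u : Fin m → ℂ) :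
    star u ⬝ᵥ (((Complex.I * ω) • (G - Gᴴ)) *ᵥ u)
      = ((2 * ((Complex.I * ω) * (star u ⬝ᵥ (G *ᵥ u))).re : ℝ) : ℂ) := by
  have h : star u ⬝ᵥ (Gᴴ *ᵥ u) = star (star u ⬝ᵥ (G *ᵥ u)) := by
    rw [star_star_dotProduct, Matrix.star_mulVec, ← Matrix.dotProduct_mulVec]
  rw [Matrix.smul_mulVec, Matrix.sub_mulVec, dotProduct_smul, dotProduct_sub, h, smul_eq_mul]
  apply Complex.ext
  · simp; ring
  · simp

lemma StorageInequality.eigenvalue_re_nonpos (h : StorageInequality A B C P) (hP : P.PosDef)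
    {s : ℂ} {v : Fin n → ℂ} (hv0 : v ≠ 0) (hv : toC A *ᵥ v = s • v) : s.re ≤ 0 := by
  have h1 := h.passive (isSymm_of_posDef hP) (s := s) (x := v) (u := 0) (by simp [hv])
  simp only [star_zero, zero_dotProduct, mul_zero, Complex.zero_re] at h1
  have := energy_pos hP hv0
  by_contra hs
  nlinarith

/-- If Av = 0, the first variation at v gives v*P(Ax + Bu) = 0 for all x and u. Controllability
allows Ax + Bu = v, so v*Pv = 0. -/
lemma StorageInequality.eigenvalue_ne_zero (hc : Controllable A B)
    (h : StorageInequality A B C P) (hP : P.PosDef)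
    {v : Fin n → ℂ} (hv0 : v ≠ 0) : toC A *ᵥ v ≠ 0 := by
  intro hv
  have hs := isSymm_of_posDef hP
  have h1 := h.variation hs (v := v) (by simp [hv])
  obtain ⟨x, u, -, -, hy⟩ := hc.exists_rightInverse v
  have h2 := h1 (x 0) (u 0)
  have h3 : toC A *ᵥ x 0 + toC B *ᵥ u 0 = v := by
    rw [← hy 0]; simp [add_comm]
  rw [h3, hv, star_dotProduct_self hs] at h2
  simp only [Matrix.mulVec_zero, star_zero, zero_dotProduct, add_zero] at h2
  exact (energy_pos hP hv0).ne (by exact_mod_cast h2)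

lemma meromorphicAt_ratFunc (g : RatFunc ℝ) (c : ℂ) :
    MeromorphicAt (fun s : ℂ => g.eval (algebraMap ℝ ℂ) s) c := by
  have h1 : ∀ p : Polynomial ℝ, MeromorphicAt (fun s : ℂ => p.eval₂ (algebraMap ℝ ℂ) s) c := by
    intro p
    simp only [← Polynomial.eval_map]
    exact (Polynomial.differentiable _).analyticAt c |>.meromorphicAt
  exact (h1 _).div (h1 _)

lemma tendsto_add_smul_nhdsNE (c d : ℂ) (hd : d ≠ 0) :
    Filter.Tendsto (fun ε : ℝ => c + ε * d) (𝓝[>] 0) (𝓝[≠] c) := by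
  refine tendsto_nhdsWithin_iff.2 ⟨?_, ?_⟩
  · have : Continuous fun ε : ℝ => c + ε * d := by fun_prop
    have h := this.tendsto 0
    simp only [Complex.ofReal_zero, zero_mul, add_zero] at h
    exact h.mono_left nhdsWithin_le_nhds
  · filter_upwards [self_mem_nhdsWithin] with ε hε
    have : (ε : ℂ) ≠ 0 := by exact_mod_cast (ne_of_gt hε)
    simp [this, hd]

/-- With zero input, A is dissipative for the inner product of P, so σ = Re s satisfies σ²·x*Px ≤
b*Pb. Young's inequality applied to g and σx concludes. -/
lemma StorageInequality.resolvent_bound (h : StorageInequality A B C P) (hP : P.PosDef) {s : ℂ}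
    (hs : 0 < s.re) {x b : Fin n → ℂ} (hx : s • x - toC A *ᵥ x = b) (g : Fin n → ℂ) :
    s.re * ‖star g ⬝ᵥ (toC P *ᵥ x)‖ ≤ energy P g + energy P b := by
  have hsym := isSymm_of_posDef hP
  have h1 := h.complex x 0
  simp only [Matrix.mulVec_zero, add_zero, dotProduct_zero, Complex.zero_re] at h1
  have h2 := energy_nonneg hP (b - (s.re : ℂ) • x)
  have h3 : (star x ⬝ᵥ (toC P *ᵥ b)).re
      = s.re * energy P x - (star x ⬝ᵥ (toC P *ᵥ (toC A *ᵥ x))).re := by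
    rw [← hx, Matrix.mulVec_sub, dotProduct_sub, Matrix.mulVec_smul, dotProduct_smul,
      star_dotProduct_self hsym, smul_eq_mul, Complex.sub_re, Complex.re_mul_ofReal]
  have h4 := congrArg Complex.re (star_dotProduct_symm hsym x b)
  rw [Complex.star_def, Complex.conj_re] at h4
  have h5 : energy P (b - (s.re : ℂ) • x) = energy P b - 2 * s.re * (star x ⬝ᵥ (toC P *ᵥ b)).re
      + s.re ^ 2 * energy P x := by
    simp only [energy, Matrix.mulVec_sub, Matrix.mulVec_smul, star_sub, star_smul, sub_dotProduct,
      dotProduct_sub, smul_dotProduct, dotProduct_smul, smul_eq_mul, Complex.sub_re,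
      Complex.star_def, Complex.conj_ofReal, Complex.re_ofReal_mul]
    rw [← h4]; ring
  have h6 := norm_form_le hP g ((s.re : ℂ) • x)
  have h7 : energy P ((s.re : ℂ) • x) = s.re ^ 2 * energy P x := by
    simp only [energy, Matrix.mulVec_smul, star_smul, smul_dotProduct, dotProduct_smul,
      smul_eq_mul, Complex.star_def, Complex.conj_ofReal, Complex.re_ofReal_mul]
    ring
  rw [Matrix.mulVec_smul, dotProduct_smul, smul_eq_mul, norm_mul, Complex.norm_real,
    Real.norm_of_nonneg hs.le, h7] at h6
  have h8 := energy_nonneg hP g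
  have h9 : 0 ≤ s.re * ‖star g ⬝ᵥ (toC P *ᵥ x)‖ := by positivity
  nlinarith

lemma exists_form_eq (hP : P.PosDef) (w : Fin n → ℝ) :
    ∃ g : Fin n → ℂ, ∀ x, star g ⬝ᵥ (toC P *ᵥ x) = vecC w ⬝ᵥ x := by
  have hs := isSymm_of_posDef hP
  refine ⟨vecC (P⁻¹ *ᵥ w), fun x => ?_⟩
  have h1 : star (vecC (P⁻¹ *ᵥ w)) = vecC (P⁻¹ *ᵥ w) := by ext; simp [vecC]
  have hd : IsUnit P.det := isUnit_iff_ne_zero.2 hP.det_pos.ne'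
  have h2 := toC_mulVec_dotProduct P (vecC (P⁻¹ *ᵥ w)) x
  rw [hs.eq] at h2
  rw [h1, ← h2, toC_mulVec_vecC, Matrix.mulVec_mulVec, Matrix.mul_nonsing_inv _ hd,
    Matrix.one_mulVec]

/-- A dissipative system has at most simple poles on the imaginary axis. -/
lemma StorageInequality.exists_residue (h : StorageInequality A B C P) (hP : P.PosDef) {c : ℂ}
    (hc : c.re = 0) (i j : Fin m) :
    ∃ k : ℂ, Filter.Tendsto
      (fun s : ℂ => ((s - c) * s) * evalAt (transferFunction A B C) s i j) (𝓝[≠] c) (𝓝 k) := by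
  have hmer : MeromorphicAt
      (fun s : ℂ => ((s - c) * s) * evalAt (transferFunction A B C) s i j) c :=
    ((by fun_prop : MeromorphicAt (fun s : ℂ => (s - c) * s) c)).mul (meromorphicAt_ratFunc _ c)
  rw [tendsto_nhds_iff_meromorphicOrderAt_nonneg hmer]
  by_contra hneg
  rw [not_le, ← tendsto_cobounded_iff_meromorphicOrderAt_neg hmer] at hneg
  -- A meromorphic function of negative order is unbounded along every approach. On the horizontal
  -- ray |s - c| = Re s, so the resolvent bound keeps this one bounded.
  have hray := tendsto_add_smul_nhdsNE c 1 one_ne_zero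
  have h1 := tendsto_norm_cobounded_atTop.comp (hneg.comp hray)
  obtain ⟨g, hg⟩ := exists_form_eq hP (C i)
  set b : Fin n → ℂ := toC B *ᵥ Pi.single j 1 with hb
  have hlt : ∀ᶠ ε : ℝ in 𝓝[>] 0, ε < 1 := nhdsWithin_le_nhds (Iio_mem_nhds one_pos)
  have h2 := h1.eventually_gt_atTop ((‖c‖ + 1) * (energy P g + energy P b))
  obtain ⟨ε, hε, hε0, hε1, hreg⟩ := (h2.and (eventually_mem_nhdsWithin.and (hlt.and (hray.eventually (eventually_charpoly_ne_zero A c))))).exists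
  have hε0' : 0 < ε := hε0
  have hε1' : ε < 1 := hε1
  set s : ℂ := c + ε * 1 with hs
  obtain ⟨x, hx⟩ := exists_resolvent hreg b
  have h3 := evalAt_mulVec (C := C) hreg hx
  have h4 : evalAt (transferFunction A B C) s i j = star g ⬝ᵥ (toC P *ᵥ x) := by
    have := congrFun h3 i
    rw [Matrix.mulVec_single_one] at this
    rw [hg]
    exact this
  have hsre : s.re = ε := by simp [hs, hc]
  have h5 := h.resolvent_bound hP (by rw [hsre]; exact hε0) hx g
  have h6 : ‖s‖ ≤ ‖c‖ + 1 := by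
    refine (norm_add_le _ _).trans ?_
    simp [abs_of_pos hε0', hε1'.le]
  have h7 : ‖s - c‖ = s.re := by
    rw [hsre]; simp [hs, abs_of_pos hε0']
  simp only [Function.comp_apply] at hε
  rw [h4, norm_mul, norm_mul, h7] at hε
  have h8 : 0 ≤ s.re * ‖star g ⬝ᵥ (toC P *ᵥ x)‖ := by rw [hsre]; positivity
  have h9 : s.re * ‖s‖ * ‖star g ⬝ᵥ (toC P *ᵥ x)‖ ≤ (‖c‖ + 1) * (energy P g + energy P b) :=
    calc _ = ‖s‖ * (s.re * ‖star g ⬝ᵥ (toC P *ᵥ x)‖) := by ring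
      _ ≤ _ := mul_le_mul h6 h5 h8 (by positivity)
  linarith

/-- The dual cone of the right half-plane is the nonnegative real axis; the directions 1 + it
suffice. -/
lemma nonneg_of_re_mul_nonneg {k : ℂ} (h : ∀ d : ℂ, 0 < d.re → 0 ≤ (star d * k).re) : 0 ≤ k := by
  have h1 : ∀ t : ℝ, 0 ≤ k.re + t * k.im := fun t => by
    simpa using h ⟨1, t⟩ (by simp)
  have h2 : k.im = 0 := by
    by_contra hk
    have := h1 (-(k.re + 1) / k.im)
    rw [div_mul_cancel₀ _ hk] at this
    linarith
  rw [Complex.nonneg_iff]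
  exact ⟨by simpa using h1 0, h2.symm⟩

theorem StorageInequality.isNegativeImaginary (hc : Controllable A B) (ho : Observable A B C)
    (hP : P.PosDef) (h : StorageInequality A B C P) :
    IsNegativeImaginary (transferFunction A B C) := by
  have hsym := isSymm_of_posDef hP
  refine ⟨?_, ?_, ?_, ?_⟩
  · rw [isPole_iff hc ho]
    rintro ⟨v, hv0, hv⟩
    exact h.eigenvalue_ne_zero hc hP hv0 (by simpa using hv)
  · intro s hs
    rw [isPole_iff hc ho]
    rintro ⟨v, hv0, hv⟩
    exact absurd (h.eigenvalue_re_nonpos hP hv0 hv) (not_le.2 hs)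
  · intro ω hω hp
    rw [isPole_iff hc ho, ← eval₂_charpoly_eq_zero_iff] at hp
    refine posSemidef_of_nonneg fun u => ?_
    obtain ⟨x, hx⟩ := exists_resolvent hp (toC B *ᵥ u)
    rw [form_smul_sub_conjTranspose, evalAt_mulVec hp hx]
    have := h.passive hsym hx
    simp only [Complex.mul_re, Complex.I_re, Complex.I_im, Complex.ofReal_re, Complex.ofReal_im,
      zero_mul, mul_zero, sub_zero] at this
    rw [Complex.zero_le_real]
    simp only [Complex.mul_re, Complex.I_re, Complex.I_im, Complex.ofReal_re, Complex.ofReal_im,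
      zero_mul, mul_zero, sub_zero]
    linarith
  · intro ω hω _
    set c : ℂ := Complex.I * ω with hcdef
    have hcre : c.re = 0 := by simp [c]
    choose k hk using fun i j => h.exists_residue (B := B) (C := C) hP hcre i j
    have hK : Filter.Tendsto (fun s : ℂ => ((s - c) * s) • evalAt (transferFunction A B C) s)
        (𝓝[≠] c) (𝓝 (Matrix.of k)) :=
      tendsto_pi_nhds.2 fun i => tendsto_pi_nhds.2 fun j => hk i j
    refine ⟨Matrix.of k, hK, posSemidef_of_nonneg fun u => nonneg_of_re_mul_nonneg fun d hd => ?_⟩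
    have hd0 : d ≠ 0 := fun h0 => by simp [h0] at hd
    have h1 : Filter.Tendsto
        (fun s : ℂ => (star d * (star u ⬝ᵥ
          ((((s - c) * s) • evalAt (transferFunction A B C) s) *ᵥ u))).re)
        (𝓝[≠] c) (𝓝 (star d * (star u ⬝ᵥ (Matrix.of k *ᵥ u))).re) := by
      have hm : Continuous fun v : Fin m → ℂ => (star d * (star u ⬝ᵥ v)).re := by fun_prop
      exact (hm.tendsto _).comp (tendsto_mulVec hK tendsto_const_nhds)
    have hray := tendsto_add_smul_nhdsNE c d hd0
    refine ge_of_tendsto (h1.comp hray) ?_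
    filter_upwards [self_mem_nhdsWithin, hray.eventually (eventually_charpoly_ne_zero A c)]
      with ε hε hreg
    have hε' : 0 < ε := hε
    obtain ⟨x, hx⟩ := exists_resolvent hreg (toC B *ᵥ u)
    have h2 := h.passive hsym hx
    have h3 : 0 ≤ (c + ε * d).re * energy P x := by
      have := energy_nonneg hP x
      have : 0 ≤ (c + ε * d).re := by simp [hcre]; positivity
      positivity
    simp only [Function.comp_apply]
    rw [Matrix.smul_mulVec, evalAt_mulVec hreg hx, dotProduct_smul, smul_eq_mul]
    -- On the ray s = c + εd, the factor conj(d)(s - c) equals ε|d|², leaving the passive quantity s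
    -- u*Gu. Every direction d is needed, to force the limit form to be real.
    have h4 : star d * ((c + ε * d - c) * (c + ε * d) * (star u ⬝ᵥ (toC C *ᵥ x)))
        = ((ε * Complex.normSq d : ℝ) : ℂ) * ((c + ε * d) * (star u ⬝ᵥ (toC C *ᵥ x))) := by
      rw [Complex.ofReal_mul, Complex.normSq_eq_conj_mul_self, Complex.star_def]
      ring
    rw [h4, Complex.re_ofReal_mul]
    have := Complex.normSq_nonneg d
    exact mul_nonneg (by positivity) (h3.trans h2)

end NegImag

/-! ### Lyapunov inequalities -/

namespace NegImag

variable {n : ℕ} {P : Matrix (Fin n) (Fin n) ℝ}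

/-- A linear map on a finite-dimensional complex space all of whose eigenvalues lie in the open
unit disc is power convergent to zero. -/
lemma tendsto_pow_of_eigenvalue_lt_one {E : Type*} [NormedAddCommGroup E] [NormedSpace ℂ E]
    [FiniteDimensional ℂ E] [Nontrivial E] (T : Module.End ℂ E)
    (hT : ∀ μ, T.HasEigenvalue μ → ‖μ‖ < 1) (x : E) :
    Filter.Tendsto (fun k : ℕ => (T ^ k) x) Filter.atTop (𝓝 0) := by
  have : CompleteSpace E := FiniteDimensional.complete ℂ E
  let S : E →L[ℂ] E := Module.End.toContinuousLinearMap E T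
  have hS : ∀ z ∈ spectrum ℂ S, ‖z‖₊ < (1 : NNReal) := by
    intro z hz
    rw [AlgEquiv.spectrum_eq (Module.End.toContinuousLinearMap E) T] at hz
    exact hT z (Module.End.hasEigenvalue_iff_mem_spectrum.2 hz)
  have h1 := spectrum.spectralRadius_lt_of_forall_lt S hS
  obtain ⟨q, hq1, hq2⟩ := ENNReal.lt_iff_exists_nnreal_btwn.1 h1
  -- Gelfand's formula: eventually ‖Sᵏ‖ ≤ qᵏ with q < 1.
  have h2 := (spectrum.pow_nnnorm_pow_one_div_tendsto_nhds_spectralRadius S).eventually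
    (gt_mem_nhds hq1)
  have hq : (q : ℝ) < 1 := by exact_mod_cast hq2
  have h3 : Filter.Tendsto (fun k : ℕ => (q : ℝ) ^ k * ‖x‖) Filter.atTop (𝓝 0) := by
    simpa using (tendsto_pow_atTop_nhds_zero_of_lt_one q.2 hq).mul_const ‖x‖
  refine squeeze_zero_norm' ?_ h3
  filter_upwards [h2, Filter.eventually_gt_atTop 0] with k hk hk0
  have hk0' : (k : ℝ) ≠ 0 := by positivity
  have h4 : ‖S ^ k‖₊ ≤ q ^ k := by
    have h5 := ENNReal.rpow_le_rpow hk.le (Nat.cast_nonneg (α := ℝ) k)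
    rw [← ENNReal.rpow_mul, one_div, inv_mul_cancel₀ hk0', ENNReal.rpow_one,
      ENNReal.rpow_natCast] at h5
    exact_mod_cast h5
  have h6 : (T ^ k) x = (S ^ k) x := by
    have : S ^ k = Module.End.toContinuousLinearMap E (T ^ k) := (map_pow _ T k).symm
    rw [this]; rfl
  rw [h6]
  exact ((S ^ k).le_opNorm x).trans
    (mul_le_mul_of_nonneg_right (by exact_mod_cast h4) (norm_nonneg _))

lemma continuous_energy (P : Matrix (Fin n) (Fin n) ℝ) : Continuous (energy P) := by
  have : Continuous fun x : Fin n → ℂ => toC P *ᵥ x :=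
    continuous_const.matrix_mulVec continuous_id
  unfold energy
  exact Complex.continuous_re.comp (continuous_star.dotProduct this)

lemma energy_add (hP : P.IsSymm) (x y : Fin n → ℂ) :
    energy P (x + y) = energy P x + energy P y + 2 * (star x ⬝ᵥ (toC P *ᵥ y)).re := by
  have h := congrArg Complex.re (star_dotProduct_symm hP x y)
  rw [Complex.star_def, Complex.conj_re] at h
  simp only [energy, Matrix.mulVec_add, star_add, add_dotProduct, dotProduct_add, Complex.add_re]
  linarith

lemma energy_neg (P : Matrix (Fin n) (Fin n) ℝ) (x : Fin n → ℂ) :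
    energy P (-x) = energy P x := by
  simp [energy, Matrix.mulVec_neg]

/-- Lyapunov's theorem with a semidefinite right-hand side for a Hurwitz map. -/
lemma energy_nonneg_of_hurwitz (hP : P.IsSymm) (M : Module.End ℂ (Fin n → ℂ))
    (hL : ∀ x, (star x ⬝ᵥ (toC P *ᵥ M x)).re ≤ 0)
    (hM : ∀ (μ : ℂ) (v : Fin n → ℂ), v ≠ 0 → M v = μ • v → μ.re < 0) (x : Fin n → ℂ) :
    0 ≤ energy P x := by
  rcases subsingleton_or_nontrivial (Fin n → ℂ) with hn | hn
  · rw [Subsingleton.elim x 0]; simp [energy]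
  have hinj : Function.Injective (1 - M : Module.End ℂ (Fin n → ℂ)) := by
    rw [injective_iff_map_eq_zero]
    intro v hv
    by_contra hv0
    have h := hM 1 v hv0 (by
      rw [one_smul]
      exact (sub_eq_zero.1 hv).symm)
    norm_num at h
  let e := LinearEquiv.ofInjectiveEndo (1 - M) hinj
  have he : ∀ z, e z = z - M z := fun z => rfl
  -- The Cayley transform moves the spectrum into the unit disc. The energy decreases under it
  -- because E(z + Mz) - E(z - Mz) = 4 Re z*PMz ≤ 0, and the iterates tend to 0, so E(x) ≥ 0.
  let T : Module.End ℂ (Fin n → ℂ) := (1 + M) ∘ₗ e.symm.toLinearMap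
  have hTe : ∀ z, T (e z) = z + M z := fun z => by simp [T]
  have hdecr : ∀ y, energy P (T y) ≤ energy P y := by
    intro y
    obtain ⟨z, rfl⟩ := e.surjective y
    rw [hTe, he, energy_add hP, sub_eq_add_neg, energy_add hP, energy_neg, Matrix.mulVec_neg,
      dotProduct_neg, Complex.neg_re]
    linarith [hL z]
  have hpow : ∀ k : ℕ, energy P ((T ^ k) x) ≤ energy P x := by
    intro k
    induction k with
    | zero => simp
    | succ k ih =>
      rw [pow_succ', Module.End.mul_apply]
      exact (hdecr _).trans ih
  have heig : ∀ μ, T.HasEigenvalue μ → ‖μ‖ < 1 := by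
    intro μ hμ
    obtain ⟨y, hy⟩ := hμ.exists_hasEigenvector
    obtain ⟨z, rfl⟩ := e.surjective y
    have hz0 : z ≠ 0 := fun h => hy.2 (by simp [h])
    have h1 := hy.apply_eq_smul
    rw [hTe, he] at h1
    have h2 : (1 + μ) • M z = (μ - 1) • z := by
      rw [smul_sub] at h1
      rw [add_smul, sub_smul, one_smul, one_smul]
      linear_combination (exp := 1) h1
    have h3 : 1 + μ ≠ 0 := by
      intro h
      rw [h, zero_smul, eq_comm, smul_eq_zero] at h2
      rcases h2 with h2 | h2
      · have : (2 : ℂ) = 0 := by linear_combination h - h2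
        norm_num at this
      · exact hz0 h2
    have h4 : M z = ((μ - 1) / (1 + μ)) • z := by
      rw [div_eq_inv_mul, mul_smul, ← h2, smul_smul, inv_mul_cancel₀ h3, one_smul]
    have h5 := hM _ z hz0 h4
    have h6 : 0 < Complex.normSq (1 + μ) := Complex.normSq_pos.2 h3
    have h7 : ((μ - 1) / (1 + μ)).re * Complex.normSq (1 + μ) = Complex.normSq μ - 1 := by
      rw [Complex.div_re]
      field_simp
      simp [Complex.normSq_apply]
      ring
    have h8 : Complex.normSq μ < 1 := by nlinarith
    rw [Complex.normSq_eq_norm_sq] at h8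
    nlinarith [norm_nonneg μ]
  have h1 := ((continuous_energy P).tendsto 0).comp (tendsto_pow_of_eigenvalue_lt_one T heig x)
  have h2 : energy P (0 : Fin n → ℂ) = 0 := by simp [energy]
  rw [h2] at h1
  exact le_of_tendsto h1 (Filter.Eventually.of_forall hpow)

/-- The form -Re x*PMx is nonnegative and vanishes at v, so its polarization with v vanishes too. -/
lemma lyapunov_variation (hP : P.IsSymm) {M : Module.End ℂ (Fin n → ℂ)}
    (hL : ∀ x, (star x ⬝ᵥ (toC P *ᵥ M x)).re ≤ 0) {v : Fin n → ℂ}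
    (hv : (star v ⬝ᵥ (toC P *ᵥ M v)).re = 0) (x : Fin n → ℂ) :
    star v ⬝ᵥ (toC P *ᵥ M x) + star (M v) ⬝ᵥ (toC P *ᵥ x) = 0 := by
  have key : ∀ x : Fin n → ℂ,
      (star v ⬝ᵥ (toC P *ᵥ M x) + star (M v) ⬝ᵥ (toC P *ᵥ x)).re = 0 := by
    intro x
    rw [← neg_eq_zero]
    apply linear_eq_zero_of_nonneg (b := -(star x ⬝ᵥ (toC P *ᵥ M x)).re)
    intro t
    have h1 := hL (v + (t : ℂ) • x)
    have h2 : (star x ⬝ᵥ (toC P *ᵥ M v)).re = (star (M v) ⬝ᵥ (toC P *ᵥ x)).re := by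
      rw [← star_dotProduct_symm hP]; simp
    simp only [map_add, map_smul, Matrix.mulVec_add, Matrix.mulVec_smul, star_add, star_smul,
      add_dotProduct, dotProduct_add, smul_dotProduct, dotProduct_smul, smul_eq_mul,
      Complex.add_re, Complex.star_def, Complex.conj_ofReal, Complex.re_ofReal_mul] at h1 ⊢
    rw [h2, hv] at h1
    linarith
  have h2 := key (Complex.I • x)
  simp only [map_smul, Matrix.mulVec_smul, dotProduct_smul, smul_eq_mul, ← mul_add,
    Complex.I_mul_re] at h2
  exact Complex.ext (key x) (by rw [Complex.zero_im]; linarith)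

/-- Lyapunov's theorem for a map with spectrum in the closed left half-plane, provided the form
is positive on the eigenvectors of imaginary eigenvalues. -/
theorem energy_nonneg_of_lyapunov (hP : P.IsSymm) (M : Module.End ℂ (Fin n → ℂ))
    (hL : ∀ x, (star x ⬝ᵥ (toC P *ᵥ M x)).re ≤ 0)
    (hM : ∀ (μ : ℂ) (v : Fin n → ℂ), v ≠ 0 → M v = μ • v → μ.re ≤ 0)
    (hpos : ∀ (μ : ℂ) (v : Fin n → ℂ), v ≠ 0 → μ.re = 0 → M v = μ • v → 0 < energy P v)
    (x : Fin n → ℂ) : 0 ≤ energy P x := by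
  -- Imaginary eigenvectors are removed one at a time, keeping P and changing M, until the Hurwitz
  -- case applies.
  induction hd : Module.finrank ℂ (Submodule.span ℂ
      {v : Fin n → ℂ | ∃ μ : ℂ, μ.re = 0 ∧ M v = μ • v}) using Nat.strong_induction_on
      generalizing M with
  | _ d ih =>
  by_cases hh : ∀ (μ : ℂ) (v : Fin n → ℂ), v ≠ 0 → M v = μ • v → μ.re < 0
  · exact energy_nonneg_of_hurwitz hP M hL hh x
  push Not at hh
  obtain ⟨c, v, hv0, hv, hc⟩ := hh
  have hc0 : c.re = 0 := le_antisymm (hM c v hv0 hv) hc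
  have hvp := hpos c v hv0 hc0 hv
  have hvL : (star v ⬝ᵥ (toC P *ᵥ M v)).re = 0 := by
    rw [hv, Matrix.mulVec_smul, dotProduct_smul, star_dotProduct_self hP, smul_eq_mul,
      Complex.re_mul_ofReal, hc0, zero_mul]
  have hcc : star c = -c := by
    apply Complex.ext <;> simp [hc0]
  have hleft : ∀ y, star v ⬝ᵥ (toC P *ᵥ M y) = c * (star v ⬝ᵥ (toC P *ᵥ y)) := by
    intro y
    have h := lyapunov_variation hP hL hvL y
    rw [hv, star_smul, hcc, smul_dotProduct, smul_eq_mul] at h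
    linear_combination h
  let r : ℝ := (energy P v)⁻¹
  have hr : 0 < r := inv_pos.2 hvp
  let φ : (Fin n → ℂ) →ₗ[ℂ] ℂ :=
    { toFun := fun y => r * (star v ⬝ᵥ (toC P *ᵥ y))
      map_add' := fun y z => by rw [Matrix.mulVec_add, dotProduct_add, mul_add]
      map_smul' := fun a y => by
        rw [Matrix.mulVec_smul, dotProduct_smul, RingHom.id_apply, smul_eq_mul, smul_eq_mul]
        ring }
  have hφ : ∀ y, φ y = r * (star v ⬝ᵥ (toC P *ᵥ y)) := fun _ => rfl
  have hφv : φ v = 1 := by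
    rw [hφ, star_dotProduct_self hP, ← Complex.ofReal_mul, inv_mul_cancel₀ hvp.ne',
      Complex.ofReal_one]
  have hφM : ∀ y, φ (M y) = c * φ y := fun y => by rw [hφ, hφ, hleft]; ring
  -- The functional φ = v*P / v*Pv is a left eigenvector for c with φ(v) = 1. This rank-one
  -- deflation shifts c to c - 1 on v and subtracts |v*Px|² / v*Pv from x*PMx, so the Lyapunov
  -- inequality survives.
  let M' : Module.End ℂ (Fin n → ℂ) := M - φ.smulRight v
  have hM' : ∀ y, M' y = M y - φ y • v := fun y => rfl
  have hsplit : ∀ (μ : ℂ) (w : Fin n → ℂ), M' w = μ • w →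
      (φ w = 0 ∧ M w = μ • w) ∨ μ = c - 1 := by
    intro μ w hw
    have h1 := congrArg φ hw
    rw [hM', map_sub, map_smul, map_smul, hφM, hφv, smul_eq_mul, smul_eq_mul] at h1
    by_cases h : φ w = 0
    · left
      refine ⟨h, ?_⟩
      rwa [hM', h, zero_smul, sub_zero] at hw
    · right
      have : φ w * (μ - (c - 1)) = 0 := by linear_combination -h1
      exact sub_eq_zero.1 ((mul_eq_zero.1 this).resolve_left h)
  have hre : (c - 1).re < 0 := by simp [hc0]
  refine ih _ ?_ M' ?_ ?_ ?_ rfl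
  · rw [← hd]
    apply Submodule.finrank_lt_finrank_of_lt
    have hsub : ∀ w ∈ {w : Fin n → ℂ | ∃ μ : ℂ, μ.re = 0 ∧ M' w = μ • w},
        φ w = 0 ∧ w ∈ {w : Fin n → ℂ | ∃ μ : ℂ, μ.re = 0 ∧ M w = μ • w} := by
      rintro w ⟨μ, hμ, hw⟩
      rcases hsplit μ w hw with ⟨h1, h2⟩ | h
      · exact ⟨h1, μ, hμ, h2⟩
      · rw [h] at hμ
        exact absurd hμ hre.ne
    refine lt_of_le_of_ne (Submodule.span_mono fun w hw => (hsub w hw).2) ?_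
    intro heq
    have hvmem : v ∈ Submodule.span ℂ {w : Fin n → ℂ | ∃ μ : ℂ, μ.re = 0 ∧ M' w = μ • w} := by
      rw [heq]
      exact Submodule.subset_span ⟨c, hc0, hv⟩
    have hle : Submodule.span ℂ {w : Fin n → ℂ | ∃ μ : ℂ, μ.re = 0 ∧ M' w = μ • w}
        ≤ LinearMap.ker φ := Submodule.span_le.2 fun w hw => (hsub w hw).1
    have := hle hvmem
    rw [LinearMap.mem_ker, hφv] at this
    exact one_ne_zero this
  · intro y
    have h1 : star y ⬝ᵥ (toC P *ᵥ M' y) = star y ⬝ᵥ (toC P *ᵥ M y)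
        - ((r * Complex.normSq (star v ⬝ᵥ (toC P *ᵥ y)) : ℝ) : ℂ) := by
      rw [hM', Matrix.mulVec_sub, dotProduct_sub, Matrix.mulVec_smul, dotProduct_smul, smul_eq_mul,
        hφ, ← star_dotProduct_symm hP v y, Complex.ofReal_mul, Complex.normSq_eq_conj_mul_self,
        Complex.star_def]
      ring
    rw [h1, Complex.sub_re, Complex.ofReal_re]
    have := Complex.normSq_nonneg (star v ⬝ᵥ (toC P *ᵥ y))
    have h2 := hL y
    have h3 : 0 ≤ r * Complex.normSq (star v ⬝ᵥ (toC P *ᵥ y)) := by positivity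
    linarith
  · intro μ w hw0 hw
    rcases hsplit μ w hw with ⟨-, h⟩ | h
    · exact hM μ w hw0 h
    · rw [h]; exact hre.le
  · intro μ w hw0 hμ hw
    rcases hsplit μ w hw with ⟨-, h⟩ | h
    · exact hpos μ w hw0 hμ h
    · rw [h] at hμ
      exact absurd hμ hre.ne

end NegImag

/-! ### Isometries and moments of families of state-input pairs -/

namespace NegImag

section Unitary

variable {E : Type*} [NormedAddCommGroup E] [InnerProductSpace ℂ E]

lemma norm_eigenvalue_isometry (W : E →ₗᵢ[ℂ] E) {μ : ℂ} {v : E} (hv : W v = μ • v)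
    (hv0 : v ≠ 0) : ‖μ‖ = 1 := by
  have h := W.norm_map v
  rw [hv, norm_smul] at h
  have := norm_pos_iff.2 hv0
  field_simp at h
  exact h

/-- Linear isometries of a finite-dimensional complex inner product space are diagonalizable in
an orthonormal basis. -/
lemma exists_orthonormalBasis_isometry [FiniteDimensional ℂ E] (W : E →ₗᵢ[ℂ] E) :
    ∃ (b : OrthonormalBasis (Fin (Module.finrank ℂ E)) ℂ E) (μ : Fin (Module.finrank ℂ E) → ℂ),
      ∀ i, W (b i) = μ i • b i := by
  classical
  let T : Module.End ℂ E := W.toLinearMap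
  have hT : ∀ v, T v = W v := fun _ => rfl
  have hT1 : ∀ {μ : ℂ} {v : E}, v ∈ T.eigenspace μ → W v = μ • v := fun h =>
    Module.End.mem_eigenspace_iff.1 h
  have horth : OrthogonalFamily ℂ (fun μ : Module.End.Eigenvalues T => T.eigenspace (μ : ℂ))
      fun μ => (T.eigenspace (μ : ℂ)).subtypeₗᵢ := by
    refine OrthogonalFamily.of_pairwise ?_
    intro μ ν hμν v hv w hw
    have hv' := hT1 hv
    have hw' := hT1 hw
    by_cases hv0 : v = 0
    · simp [hv0]
    have hμ1 := norm_eigenvalue_isometry W hv' hv0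
    have h1 := W.inner_map_map v w
    rw [hv', hw', inner_smul_left, inner_smul_right] at h1
    have h2 : (starRingEnd ℂ) (μ : ℂ) * (μ : ℂ) = 1 := by
      rw [Complex.conj_mul', hμ1]; simp
    refine inner_eq_zero_symm.1 ?_
    by_contra h3
    have h4 : (starRingEnd ℂ) (μ : ℂ) * (ν : ℂ) = 1 := by
      have : ((starRingEnd ℂ) (μ : ℂ) * (ν : ℂ) - 1) * inner ℂ v w = 0 := by
        linear_combination h1
      exact sub_eq_zero.1 ((mul_eq_zero.1 this).resolve_right h3)
    apply hμν
    apply Subtype.ext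
    have h5 : (starRingEnd ℂ) (μ : ℂ) ≠ 0 := left_ne_zero_of_mul_eq_one h2
    exact mul_left_cancel₀ h5 (h2.trans h4.symm)
  have hint : DirectSum.IsInternal
      (fun μ : Module.End.Eigenvalues T => T.eigenspace (μ : ℂ)) := by
    rw [horth.isInternal_iff]
    by_contra hne
    -- The complement of all eigenspaces is invariant; if nonzero it would contain an eigenvector
    -- orthogonal to itself.
    let K := (⨆ μ : Module.End.Eigenvalues T, T.eigenspace (μ : ℂ))ᗮ
    have hmem : ∀ w, w ∈ K ↔ ∀ μ : ℂ, ∀ v, W v = μ • v → inner ℂ v w = 0 := by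
      intro w
      simp only [K]
      rw [Submodule.mem_orthogonal]
      constructor
      · intro h μ v hv
        by_cases hv0 : v = 0
        · simp [hv0]
        have hμ : T.HasEigenvalue μ :=
          Module.End.hasEigenvalue_of_hasEigenvector ⟨Module.End.mem_eigenspace_iff.2 hv, hv0⟩
        exact h v (Submodule.mem_iSup_of_mem (⟨μ, hμ⟩ : Module.End.Eigenvalues T)
          (Module.End.mem_eigenspace_iff.2 hv))
      · intro h v hv
        induction hv using Submodule.iSup_induction' with
        | mem μ v hv => exact h μ v (hT1 hv)
        | zero => simp
        | add v v' _ _ h1 h2 => rw [inner_add_left, h1, h2, add_zero]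
    have hinv : ∀ w ∈ K, T w ∈ K := by
      intro w hw
      rw [hmem] at hw ⊢
      intro μ v hv
      by_cases hv0 : v = 0
      · simp [hv0]
      have hμ1 := norm_eigenvalue_isometry W hv hv0
      have h1 := W.inner_map_map v w
      rw [hv, inner_smul_left, hw μ v hv] at h1
      refine (mul_eq_zero.1 h1).resolve_left ?_
      intro h
      rw [map_eq_zero] at h
      simp [h] at hμ1
    have : Nontrivial K := Submodule.nontrivial_iff_ne_bot.2 hne
    obtain ⟨μ, hμ⟩ := Module.End.exists_eigenvalue (T.restrict hinv)
    obtain ⟨w, hw⟩ := hμ.exists_hasEigenvector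
    have h1 : W w = μ • (w : E) := congrArg Subtype.val hw.apply_eq_smul
    have h2 := (hmem w).1 w.2 μ w h1
    rw [inner_self_eq_zero] at h2
    exact hw.2 (Subtype.ext h2)
  refine ⟨hint.subordinateOrthonormalBasis rfl horth,
    fun i => (hint.subordinateOrthonormalBasisIndex rfl i horth : Module.End.Eigenvalues T),
    fun i => ?_⟩
  exact hT1 (hint.subordinateOrthonormalBasis_subordinate rfl i horth)

/-- Two linear maps with equal norms differ by a linear isometry. -/
lemma exists_isometry_comp_eq [FiniteDimensional ℂ E] {V : Type*} [AddCommGroup V] [Module ℂ V]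
    (p q : V →ₗ[ℂ] E) (h : ∀ a, ‖p a‖ = ‖q a‖) : ∃ W : E →ₗᵢ[ℂ] E, ∀ a, W (p a) = q a := by
  obtain ⟨g, hg⟩ := p.rangeRestrict.exists_rightInverse_of_surjective p.range_rangeRestrict
  have hg' : ∀ y : LinearMap.range p, p (g y) = y := fun y =>
    congrArg Subtype.val (LinearMap.congr_fun hg y)
  let L : LinearMap.range p →ₗᵢ[ℂ] E := ⟨q ∘ₗ g, fun y => by
    rw [LinearMap.comp_apply, ← h, hg']; rfl⟩
  refine ⟨L.extend, fun a => ?_⟩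
  have h1 : L.extend (p a) = q (g ⟨p a, LinearMap.mem_range_self p a⟩) :=
    L.extend_apply ⟨p a, LinearMap.mem_range_self p a⟩
  rw [h1, ← sub_eq_zero, ← map_sub, ← norm_eq_zero, ← h, map_sub, hg', sub_self, norm_zero]

end Unitary

variable {n m : ℕ} {A : Matrix (Fin n) (Fin n) ℝ} {B : Matrix (Fin n) (Fin m) ℝ}
  {C : Matrix (Fin m) (Fin n) ℝ} {P : Matrix (Fin n) (Fin n) ℝ}

/-- The frequency domain inequality, including infinite frequency (`x = 0`). -/
def FrequencyInequality (A : Matrix (Fin n) (Fin n) ℝ) (B : Matrix (Fin n) (Fin m) ℝ)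
    (C : Matrix (Fin m) (Fin n) ℝ) : Prop :=
  ∀ (x : Fin n → ℂ) (u : Fin m → ℂ),
    (x = 0 ∨ ∃ ω : ℝ, toC A *ᵥ x + toC B *ᵥ u = (Complex.I * ω) • x) →
      0 ≤ (star (toC C *ᵥ (toC A *ᵥ x + toC B *ᵥ u)) ⬝ᵥ u).re

lemma toC_mul {j k l : Type*} [Fintype k] (M : Matrix j k ℝ) (N : Matrix k l ℝ) :
    toC (M * N) = toC M * toC N := by
  ext; simp [Matrix.mul_apply]

/-- The frequency domain inequality is inherited by the moments of a family of state-input pairs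
whose second moment is stationary. -/
lemma FrequencyInequality.trace_nonneg (hF : FrequencyInequality A B C) {ι : Type*} [Fintype ι]
    (X : Matrix (Fin n) ι ℝ) (U : Matrix (Fin m) ι ℝ)
    (h : X * (A * X + B * U)ᵀ + (A * X + B * U) * Xᵀ = 0) :
    0 ≤ ((C * (A * X + B * U))ᵀ * U).trace := by
  classical
  set F := A * X + B * U with hFdef
  let p : (Fin n → ℂ) →ₗ[ℂ] EuclideanSpace ℂ ι :=
    (WithLp.linearEquiv 2 ℂ (ι → ℂ)).symm.toLinearMap ∘ₗ (toC (F + X)ᵀ).mulVecLin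
  let q : (Fin n → ℂ) →ₗ[ℂ] EuclideanSpace ℂ ι :=
    (WithLp.linearEquiv 2 ℂ (ι → ℂ)).symm.toLinearMap ∘ₗ (toC (F - X)ᵀ).mulVecLin
  have hin : ∀ (M : Matrix (Fin n) ι ℝ) (a : Fin n → ℂ) (e : EuclideanSpace ℂ ι),
      inner ℂ (WithLp.toLp 2 (toC Mᵀ *ᵥ a)) e = star a ⬝ᵥ (toC M *ᵥ WithLp.ofLp e) := by
    intro M a e
    rw [EuclideanSpace.inner_eq_star_dotProduct, dotProduct_comm, star_toC_mulVec,
      toC_mulVec_dotProduct, Matrix.transpose_transpose]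
  have hnorm : ∀ (M : Matrix (Fin n) ι ℝ) (a : Fin n → ℂ),
      ((‖WithLp.toLp 2 (toC Mᵀ *ᵥ a)‖ : ℂ)) ^ 2 = star a ⬝ᵥ (toC (M * Mᵀ) *ᵥ a) := by
    intro M a
    have := inner_self_eq_norm_sq_to_K (𝕜 := ℂ) (WithLp.toLp 2 (toC Mᵀ *ᵥ a))
    rw [hin] at this
    rw [toC_mul, ← Matrix.mulVec_mulVec]
    exact this.symm
  -- The stationarity hypothesis is exactly the cancellation of the cross terms. An isometry W
  -- therefore carries (F + X)ᵀa to (F - X)ᵀa.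
  have hsq : (F + X) * (F + X)ᵀ = (F - X) * (F - X)ᵀ := by
    have : F * Xᵀ = - (X * Fᵀ) := by rw [eq_neg_iff_add_eq_zero, add_comm]; exact h
    simp only [Matrix.transpose_add, Matrix.transpose_sub, Matrix.add_mul, Matrix.sub_mul,
      Matrix.mul_add, Matrix.mul_sub, this]
    abel
  obtain ⟨W, hW⟩ := exists_isometry_comp_eq p q (fun a => by
    have h1 := hnorm (F + X) a
    rw [hsq, ← hnorm] at h1
    have h2 : ‖p a‖ ^ 2 = ‖q a‖ ^ 2 := by exact_mod_cast h1
    exact (sq_eq_sq₀ (norm_nonneg _) (norm_nonneg _)).1 h2)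
  obtain ⟨b, μ, hb⟩ := exists_orthonormalBasis_isometry W
  have hrel : ∀ l, μ l • (toC (F - X) *ᵥ WithLp.ofLp (b l)) = toC (F + X) *ᵥ WithLp.ofLp (b l) := by
    intro l
    have h1 : ∀ a : Fin n → ℂ, star a ⬝ᵥ (μ l • (toC (F - X) *ᵥ WithLp.ofLp (b l)))
        = star a ⬝ᵥ (toC (F + X) *ᵥ WithLp.ofLp (b l)) := by
      intro a
      have h2 := W.inner_map_map (p a) (b l)
      rw [hW, hb, inner_smul_right] at h2
      rw [dotProduct_smul, ← hin, ← hin]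
      exact h2
    have h2 := h1 (μ l • (toC (F - X) *ᵥ WithLp.ofLp (b l)) - toC (F + X) *ᵥ WithLp.ofLp (b l))
    rw [← sub_eq_zero, ← dotProduct_sub, dotProduct_star_self_eq_zero] at h2
    exact sub_eq_zero.1 h2
  have hterm : ∀ l, 0 ≤ (star (toC (C * F) *ᵥ WithLp.ofLp (b l)) ⬝ᵥ
      (toC U *ᵥ WithLp.ofLp (b l))).re := by
    intro l
    set e := WithLp.ofLp (b l) with he
    have hf : toC F *ᵥ e = toC A *ᵥ (toC X *ᵥ e) + toC B *ᵥ (toC U *ᵥ e) := by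
      have : toC F = toC A * toC X + toC B * toC U := by
        rw [← toC_mul, ← toC_mul, hFdef]; ext; simp
      rw [this, Matrix.add_mulVec, Matrix.mulVec_mulVec, Matrix.mulVec_mulVec]
    have hadd : toC (F + X) *ᵥ e = toC F *ᵥ e + toC X *ᵥ e := by
      rw [← Matrix.add_mulVec]; congr 1; ext; simp
    have hsub : toC (F - X) *ᵥ e = toC F *ᵥ e - toC X *ᵥ e := by
      rw [← Matrix.sub_mulVec]; congr 1; ext; simp
    have hr := hrel l
    rw [← he, hadd, hsub] at hr
    have hb0 : b l ≠ 0 := fun h0 => by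
      have := b.orthonormal.1 l
      simp [h0] at this
    have hμ := norm_eigenvalue_isometry W (hb l) hb0
    rw [toC_mul, ← Matrix.mulVec_mulVec, hf]
    apply hF
    -- The relation is (μ - 1)Fe = (μ + 1)Xe. The value μ = 1 means Xe = 0, infinite frequency;
    -- otherwise (μ + 1)/(μ - 1) is imaginary because |μ| = 1.
    by_cases h1 : μ l = 1
    · left
      rw [h1, one_smul, sub_eq_iff_eq_add, add_assoc, left_eq_add, ← two_smul ℂ] at hr
      exact (smul_eq_zero.1 hr).resolve_left two_ne_zero
    · right
      have h2 : μ l - 1 ≠ 0 := sub_ne_zero.2 h1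
      have h3 : (μ l - 1) • (toC F *ᵥ e) = (μ l + 1) • (toC X *ᵥ e) := by
        rw [smul_sub] at hr
        rw [sub_smul, add_smul, one_smul, one_smul]
        linear_combination (exp := 1) hr
      have h4 : toC F *ᵥ e = ((μ l + 1) / (μ l - 1)) • (toC X *ᵥ e) := by
        rw [div_eq_inv_mul, mul_smul, ← h3, smul_smul, inv_mul_cancel₀ h2, one_smul]
      have h5 : ((μ l + 1) / (μ l - 1)).re = 0 := by
        have h6 : Complex.normSq (μ l) = 1 := by rw [Complex.normSq_eq_norm_sq, hμ]; norm_num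
        have h7 : Complex.normSq (μ l - 1) ≠ 0 := by simpa [Complex.normSq_eq_zero] using h2
        rw [Complex.div_re]
        field_simp
        rw [Complex.normSq_apply] at h6
        simp
        linear_combination h6
      refine ⟨((μ l + 1) / (μ l - 1)).im, ?_⟩
      rw [← hf, h4]
      congr 1
      apply Complex.ext
      · simpa using h5
      · simp
  let T : EuclideanSpace ℂ ι →ₗ[ℂ] EuclideanSpace ℂ ι := (toC ((C * F)ᵀ * U)).toEuclideanLin
  have hTin : ∀ e e' : EuclideanSpace ℂ ι, inner ℂ e (T e')
      = star (toC (C * F) *ᵥ WithLp.ofLp e) ⬝ᵥ (toC U *ᵥ WithLp.ofLp e') := by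
    intro e e'
    rw [star_toC_mulVec, toC_mulVec_dotProduct, Matrix.mulVec_mulVec, ← toC_mul,
      EuclideanSpace.inner_eq_star_dotProduct, dotProduct_comm]
    rfl
  -- The trace does not depend on the orthonormal basis, so it is the sum of the modal supplies.
  have h1 := (LinearMap.trace_eq_sum_inner T b).symm.trans
    (LinearMap.trace_eq_sum_inner T (EuclideanSpace.basisFun ι ℂ))
  have h2 : ∀ k, inner ℂ (EuclideanSpace.basisFun ι ℂ k) (T (EuclideanSpace.basisFun ι ℂ k))
      = ((((C * F)ᵀ * U) k k : ℝ) : ℂ) := by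
    intro k
    rw [EuclideanSpace.basisFun_apply, EuclideanSpace.inner_single_left]
    simp [T]
  have h3 : ((((C * F)ᵀ * U).trace : ℝ) : ℂ) = ∑ l, inner ℂ (b l) (T (b l)) := by
    rw [h1]
    simp only [h2]
    rw [Matrix.trace, Complex.ofReal_sum]
    rfl
  have h4 := congrArg Complex.re h3
  rw [Complex.ofReal_re, Complex.re_sum] at h4
  rw [h4]
  refine Finset.sum_nonneg fun l _ => ?_
  rw [hTin]
  exact hterm l

end NegImag

/-! ### The Kalman–Yakubovich–Popov lemma by convex separation -/

namespace NegImag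

/-- In finite dimension the convex hull of a compact set is compact. -/
lemma isCompact_convexHull {E : Type*} [NormedAddCommGroup E] [NormedSpace ℝ E]
    [FiniteDimensional ℝ E] {s : Set E} (hs : IsCompact s) : IsCompact (convexHull ℝ s) := by
  classical
  let d := Module.finrank ℝ E + 1
  let Φ : (Fin d → ℝ) × (Fin d → E) → E := fun p => ∑ i, p.1 i • p.2 i
  have hΦ : Continuous Φ := by fun_prop
  have hc : IsCompact (stdSimplex ℝ (Fin d) ×ˢ (Set.univ.pi fun _ : Fin d => s)) :=
    (isCompact_stdSimplex ℝ (Fin d)).prod (isCompact_univ_pi fun _ => hs)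
  convert hc.image hΦ using 1
  ext x
  constructor
  · intro hx
    -- Carathéodory: at most d points are needed; shorter combinations are padded with zero weights.
    obtain ⟨ι, _, z, w, hz, hind, hw, hw1, hx⟩ := eq_pos_convex_span_of_mem_convexHull hx
    have hcard : Fintype.card ι ≤ d := by
      have := hind.card_le_finrank_succ
      exact this.trans (Nat.succ_le_succ (Submodule.finrank_le _))
    obtain ⟨e⟩ : Nonempty (ι ↪ Fin d) :=
      Function.Embedding.nonempty_of_card_le (by simpa using hcard)
    have hne : Nonempty ι := by
      by_contra h
      rw [not_nonempty_iff] at h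
      simp at hw1
    let z₀ := z hne.some
    have hext : ∀ i, Function.extend e w 0 (e i) = w i := fun i => e.injective.extend_apply _ _ _
    have hext' : ∀ i, Function.extend e z (fun _ => z₀) (e i) = z i :=
      fun i => e.injective.extend_apply _ _ _
    have hout : ∀ j, j ∉ Set.range e → Function.extend e w 0 j = 0 := fun j hj =>
      Function.extend_apply' _ _ _ (by simpa using hj)
    refine ⟨(Function.extend e w 0, Function.extend e z fun _ => z₀), ⟨⟨?_, ?_⟩, ?_⟩, ?_⟩
    · intro j
      by_cases hj : j ∈ Set.range e
      · obtain ⟨i, rfl⟩ := hj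
        simp only [hext]; exact (hw i).le
      · simp only [hout j hj]; exact le_rfl
    · rw [← hw1]
      exact (Fintype.sum_of_injective e e.injective _ _ hout fun i => (hext i).symm).symm
    · intro j _
      by_cases hj : j ∈ Set.range e
      · obtain ⟨i, rfl⟩ := hj
        simp only [hext']; exact hz ⟨i, rfl⟩
      · have : Function.extend e z (fun _ => z₀) j = z₀ :=
          Function.extend_apply' _ _ _ (by simpa using hj)
        simp only [this]; exact hz ⟨_, rfl⟩
    · rw [← hx]
      refine (Fintype.sum_of_injective e e.injective _ _ (fun j hj => ?_) fun i => ?_).symm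
      · simp only [hout j hj, zero_smul]
      · simp only [hext, hext']
  · rintro ⟨⟨w, z⟩, ⟨⟨hw, hw1⟩, hz⟩, rfl⟩
    exact (convex_convexHull ℝ s).sum_mem (fun i _ => hw i) hw1
      fun i _ => subset_convexHull ℝ s (hz i trivial)

variable {n m : ℕ} {A : Matrix (Fin n) (Fin n) ℝ} {B : Matrix (Fin n) (Fin m) ℝ}
  {C : Matrix (Fin m) (Fin n) ℝ} {P : Matrix (Fin n) (Fin n) ℝ}

/-- The set of pairs `(x, u)` of Euclidean norm one. -/
def unitPairs (n m : ℕ) : Set ((Fin n → ℝ) × (Fin m → ℝ)) :=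
  {z | z.1 ⬝ᵥ z.1 + z.2 ⬝ᵥ z.2 = 1}

lemma isCompact_unitPairs : IsCompact (unitPairs n m) := by
  refine Metric.isCompact_of_isClosed_isBounded ?_ ?_
  · have h : Continuous fun z : (Fin n → ℝ) × (Fin m → ℝ) => z.1 ⬝ᵥ z.1 + z.2 ⬝ᵥ z.2 := by fun_prop
    exact isClosed_eq h continuous_const
  · refine (Metric.isBounded_closedBall (x := (0 : (Fin n → ℝ) × (Fin m → ℝ)))
      (r := 1)).subset fun z hz => ?_
    have key : ∀ {k : ℕ} (y : Fin k → ℝ), y ⬝ᵥ y ≤ 1 → ‖y‖ ≤ 1 := by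
      intro k y hy
      refine (pi_norm_le_iff_of_nonneg zero_le_one).2 fun i => ?_
      have : y i * y i ≤ y ⬝ᵥ y :=
        Finset.single_le_sum (f := fun i => y i * y i) (fun i _ => mul_self_nonneg _)
          (Finset.mem_univ i)
      rw [Real.norm_eq_abs, abs_le_one_iff_mul_self_le_one]
      linarith
    have nn : ∀ {k : ℕ} (y : Fin k → ℝ), 0 ≤ y ⬝ᵥ y := fun y =>
      Finset.sum_nonneg fun i _ => mul_self_nonneg _
    have hz' : z.1 ⬝ᵥ z.1 + z.2 ⬝ᵥ z.2 = 1 := hz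
    rw [mem_closedBall_zero_iff]
    exact max_le (key _ (by linarith [nn z.2])) (key _ (by linarith [nn z.1]))

/-- Supply and power are homogeneous of degree two, so inequalities between them are decided on this
compact sphere. -/
lemma exists_unitPairs_smul (z : (Fin n → ℝ) × (Fin m → ℝ)) :
    z = 0 ∨ ∃ r : ℝ, 0 < r ∧ ∃ y ∈ unitPairs n m, z = r • y := by
  by_cases h : z = 0
  · exact Or.inl h
  right
  have nn : ∀ {k : ℕ} (y : Fin k → ℝ), 0 ≤ y ⬝ᵥ y := fun y =>
    Finset.sum_nonneg fun i _ => mul_self_nonneg _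
  have hpos : 0 < z.1 ⬝ᵥ z.1 + z.2 ⬝ᵥ z.2 := by
    refine lt_of_le_of_ne (add_nonneg (nn _) (nn _)) fun h0 => h ?_
    have h1 : z.1 ⬝ᵥ z.1 = 0 := by linarith [nn z.1, nn z.2]
    have h2 : z.2 ⬝ᵥ z.2 = 0 := by linarith [nn z.1, nn z.2]
    exact Prod.ext (dotProduct_self_eq_zero.1 h1) (dotProduct_self_eq_zero.1 h2)
  set q := z.1 ⬝ᵥ z.1 + z.2 ⬝ᵥ z.2 with hq
  have hs : 0 < Real.sqrt q := Real.sqrt_pos.2 hpos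
  refine ⟨Real.sqrt q, hs, (Real.sqrt q)⁻¹ • z, ?_, ?_⟩
  · rw [unitPairs, Set.mem_ofPred_eq]
    simp only [Prod.smul_fst, Prod.smul_snd, smul_dotProduct, dotProduct_smul, smul_eq_mul]
    rw [← mul_add, ← mul_add, ← hq]
    have : Real.sqrt q * Real.sqrt q = q := Real.mul_self_sqrt hpos.le
    field_simp
    nlinarith
  · rw [smul_smul, mul_inv_cancel₀ hs.ne', one_smul]

/-- The supply rate `ẏᵀ u` of a pair `(x, u)`. -/
def supply (A : Matrix (Fin n) (Fin n) ℝ) (B : Matrix (Fin n) (Fin m) ℝ)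
    (C : Matrix (Fin m) (Fin n) ℝ) (z : (Fin n → ℝ) × (Fin m → ℝ)) : ℝ :=
  (C *ᵥ (A *ᵥ z.1 + B *ᵥ z.2)) ⬝ᵥ z.2

/-- The symmetric product of the state and its velocity. -/
def velocityMoment (A : Matrix (Fin n) (Fin n) ℝ) (B : Matrix (Fin n) (Fin m) ℝ)
    (z : (Fin n → ℝ) × (Fin m → ℝ)) : Fin n → Fin n → ℝ := fun i j =>
  z.1 i * (A *ᵥ z.1 + B *ᵥ z.2) j + (A *ᵥ z.1 + B *ᵥ z.2) i * z.1 j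

/-- The power `xᵀ P ẋ`. -/
def power (A : Matrix (Fin n) (Fin n) ℝ) (B : Matrix (Fin n) (Fin m) ℝ)
    (P : Matrix (Fin n) (Fin n) ℝ) (z : (Fin n → ℝ) × (Fin m → ℝ)) : ℝ :=
  z.1 ⬝ᵥ (P *ᵥ (A *ᵥ z.1 + B *ᵥ z.2))

lemma supply_smul (r : ℝ) (z : (Fin n → ℝ) × (Fin m → ℝ)) :
    supply A B C (r • z) = r ^ 2 * supply A B C z := by
  simp only [supply, Prod.smul_fst, Prod.smul_snd, Matrix.mulVec_smul, ← smul_add,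
    smul_dotProduct, dotProduct_smul, smul_eq_mul]
  ring

lemma power_smul (r : ℝ) (z : (Fin n → ℝ) × (Fin m → ℝ)) :
    power A B P (r • z) = r ^ 2 * power A B P z := by
  simp only [power, Prod.smul_fst, Prod.smul_snd, Matrix.mulVec_smul, ← smul_add,
    smul_dotProduct, dotProduct_smul, smul_eq_mul]
  ring

lemma continuous_supply : Continuous (supply A B C) := by
  unfold supply; fun_prop

lemma continuous_velocityMoment : Continuous (velocityMoment A B) := by
  unfold velocityMoment; fun_prop

/-- This turns a separating functional on moments into a symmetric candidate for P. -/
lemma sum_velocityMoment (h : Matrix (Fin n) (Fin n) ℝ) (z : (Fin n → ℝ) × (Fin m → ℝ)) :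
    ∑ i, ∑ j, h i j * velocityMoment A B z i j = power A B (h + hᵀ) z := by
  simp only [power, velocityMoment, Matrix.add_mulVec, dotProduct_add]
  simp only [dotProduct, Matrix.mulVec, mul_add, Finset.sum_add_distrib, Finset.mul_sum,
    Matrix.transpose_apply]
  congr 1
  · exact Finset.sum_congr rfl fun i _ => Finset.sum_congr rfl fun j _ => by ring
  · rw [Finset.sum_comm]
    exact Finset.sum_congr rfl fun i _ => Finset.sum_congr rfl fun j _ => by ring

/-- Scaling each pair by the square root of its weight makes the pairs columns of X and U, as
`trace_nonneg` requires. -/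
lemma FrequencyInequality.sum_nonneg (hF : FrequencyInequality A B C) {ι : Type*} [Fintype ι]
    {w : ι → ℝ} (hw : ∀ k, 0 ≤ w k) {z : ι → (Fin n → ℝ) × (Fin m → ℝ)}
    (h : ∑ k, w k • velocityMoment A B (z k) = 0) : 0 ≤ ∑ k, w k * supply A B C (z k) := by
  let X : Matrix (Fin n) ι ℝ := Matrix.of fun i k => Real.sqrt (w k) * (z k).1 i
  let U : Matrix (Fin m) ι ℝ := Matrix.of fun i k => Real.sqrt (w k) * (z k).2 i
  have hs : ∀ k, Real.sqrt (w k) * Real.sqrt (w k) = w k := fun k => Real.mul_self_sqrt (hw k)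
  have hV : ∀ i k, (A * X + B * U) i k
      = Real.sqrt (w k) * (A *ᵥ (z k).1 + B *ᵥ (z k).2) i := by
    intro i k
    simp only [Matrix.add_apply, Matrix.mul_apply, X, U, Matrix.of_apply, Pi.add_apply,
      Matrix.mulVec, dotProduct, mul_add, Finset.mul_sum]
    congr 1 <;> exact Finset.sum_congr rfl fun j _ => by ring
  have h1 : X * (A * X + B * U)ᵀ + (A * X + B * U) * Xᵀ = 0 := by
    ext i j
    have h2 := congrFun (congrFun h i) j
    simp only [Finset.sum_apply, Pi.smul_apply, smul_eq_mul, velocityMoment, Pi.zero_apply] at h2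
    rw [Matrix.add_apply, Matrix.mul_apply, Matrix.mul_apply, ← Finset.sum_add_distrib,
      Matrix.zero_apply, ← h2]
    refine Finset.sum_congr rfl fun k _ => ?_
    rw [Matrix.transpose_apply, Matrix.transpose_apply, hV, hV]
    simp only [X, Matrix.of_apply]
    linear_combination ((z k).1 i * (A *ᵥ (z k).1 + B *ᵥ (z k).2) j
      + (A *ᵥ (z k).1 + B *ᵥ (z k).2) i * (z k).1 j) * hs k
  have h3 := hF.trace_nonneg X U h1
  convert h3 using 1
  rw [Matrix.trace]
  refine Finset.sum_congr rfl fun k _ => ?_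
  rw [Matrix.diag_apply, Matrix.mul_apply, supply, dotProduct, Finset.mul_sum]
  refine Finset.sum_congr rfl fun i _ => ?_
  have h4 : (C * (A * X + B * U)) i k
      = Real.sqrt (w k) * (C *ᵥ (A *ᵥ (z k).1 + B *ᵥ (z k).2)) i := by
    rw [Matrix.mul_apply, Matrix.mulVec, dotProduct, Finset.mul_sum]
    exact Finset.sum_congr rfl fun j _ => by rw [hV]; ring
  rw [Matrix.transpose_apply, h4]
  simp only [U, Matrix.of_apply]
  linear_combination -((C *ᵥ (A *ᵥ (z k).1 + B *ᵥ (z k).2)) i * (z k).2 i) * hs k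

/-- The Kalman–Yakubovich–Popov lemma with slack `δ`. -/
lemma FrequencyInequality.exists_storage_slack (hc : Controllable A B)
    (hF : FrequencyInequality A B C) {δ : ℝ} (hδ : 0 < δ) :
    ∃ P : Matrix (Fin n) (Fin n) ℝ, P.IsSymm ∧
      ∀ z ∈ unitPairs n m, power A B P z ≤ supply A B C z + δ := by
  let g : (Fin n → ℝ) × (Fin m → ℝ) → ℝ × (Fin n → Fin n → ℝ) := fun z =>
    (supply A B C z + δ, velocityMoment A B z)
  have hg : Continuous g :=
    (continuous_supply.add continuous_const).prodMk continuous_velocityMoment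
  let K := convexHull ℝ (g '' unitPairs n m)
  let R : Set (ℝ × (Fin n → Fin n → ℝ)) := Set.Iic 0 ×ˢ {0}
  -- A convex combination with zero moment has supply at least 0, hence first coordinate at least δ
  -- > 0.
  have hdisj : Disjoint K R := by
    rw [Set.disjoint_left]
    rintro ⟨t, H⟩ hK ⟨ht, hH⟩
    obtain ⟨ι, _, w, y, hw, hw1, hy, hsum⟩ := mem_convexHull_iff_exists_fintype.1 hK
    choose z hz hzy using hy
    have ht' : t ≤ 0 := ht
    have hH' : H = 0 := hH
    have h1 := congrArg Prod.fst hsum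
    have h2 := congrArg Prod.snd hsum
    simp only [← hzy, g, Prod.fst_sum, Prod.snd_sum, Prod.smul_fst, Prod.smul_snd, smul_eq_mul,
      mul_add, Finset.sum_add_distrib, ← Finset.sum_mul, hw1, one_mul] at h1 h2
    have h3 := hF.sum_nonneg hw (h2.trans hH')
    linarith
  obtain ⟨f, a, b, hfK, hab, hfR⟩ := geometric_hahn_banach_compact_closed (convex_convexHull ℝ _)
    (isCompact_convexHull (isCompact_unitPairs.image hg))
    ((convex_Iic (0 : ℝ)).prod (convex_singleton (0 : Fin n → Fin n → ℝ)))
    (isClosed_Iic.prod isClosed_singleton) hdisj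
  let α : ℝ := f (1, 0)
  let h : Matrix (Fin n) (Fin n) ℝ := Matrix.of fun i j =>
    f (0, Pi.single i (Pi.single j 1))
  have hf : ∀ t H, f (t, H) = α * t + ∑ i, ∑ j, h i j * H i j := by
    intro t H
    have e1 : ((t, H) : ℝ × (Fin n → Fin n → ℝ)) = t • ((1 : ℝ), (0 : Fin n → Fin n → ℝ))
        + ∑ i, ∑ j, H i j • ((0 : ℝ), (Pi.single i (Pi.single j 1) : Fin n → Fin n → ℝ)) := by
      apply Prod.ext
      · simp [Prod.fst_sum]
      · funext i j
        simp [Prod.snd_sum, Finset.sum_apply, Pi.single_apply, Finset.sum_ite_eq]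
    rw [e1, map_add, map_smul, map_sum, smul_eq_mul, mul_comm]
    congr 1
    refine Finset.sum_congr rfl fun i _ => ?_
    rw [map_sum]
    refine Finset.sum_congr rfl fun j _ => ?_
    rw [map_smul, smul_eq_mul, mul_comm]
    rfl
  have hfR' : ∀ t ≤ 0, b < α * t := fun t ht => by
    have := hfR (t, 0) ⟨ht, rfl⟩
    simpa [hf] using this
  have hb : b < 0 := by simpa using hfR' 0 le_rfl
  have hα : α ≤ 0 := by
    by_contra hα
    rw [not_le] at hα
    have := hfR' (b / α) (div_nonpos_of_nonpos_of_nonneg hb.le hα.le)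
    rw [mul_div_cancel₀ _ hα.ne'] at this
    exact lt_irrefl _ this
  have hfK' : ∀ z ∈ unitPairs n m, α * (supply A B C z + δ) + power A B (h + hᵀ) z < 0 := by
    intro z hz
    have h1 := hfK (g z) (subset_convexHull ℝ _ ⟨z, hz, rfl⟩)
    rw [hf, sum_velocityMoment] at h1
    linarith
  have hsymm : (h + hᵀ).IsSymm := Matrix.isSymm_add_transpose_self h
  rcases hα.lt_or_eq with hα | hα
  · refine ⟨(-α)⁻¹ • (h + hᵀ), hsymm.smul _, fun z hz => ?_⟩
    have h1 := hfK' z hz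
    have h2 : power A B ((-α)⁻¹ • (h + hᵀ)) z = (-α)⁻¹ * power A B (h + hᵀ) z := by
      simp only [power, Matrix.smul_mulVec, dotProduct_smul, smul_eq_mul]
    rw [h2, inv_mul_le_iff₀ (by linarith)]
    linarith
  -- For a vertical hyperplane, -(h + hᵀ) would be a storage function monotone along all
  -- trajectories, hence zero. The strict separation then leaves only an empty sphere, for which 0
  -- serves.
  · have h0 : -(h + hᵀ) = 0 := by
      refine hc.eq_zero_of_monotone hsymm.neg fun x u => ?_
      rcases exists_unitPairs_smul (x, u) with hz | ⟨r, hr, y, hy, hz⟩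
      · rw [Prod.ext_iff] at hz
        have hx : x = 0 := hz.1
        simp [hx]
      · have h1 := hfK' y hy
        rw [hα, zero_mul, zero_add] at h1
        have h2 : power A B (-(h + hᵀ)) (x, u) = -(r ^ 2 * power A B (h + hᵀ) y) := by
          rw [hz, power_smul, power, Matrix.neg_mulVec, dotProduct_neg, ← power]; ring
        have h3 : 0 ≤ power A B (-(h + hᵀ)) (x, u) := by
          rw [h2]; nlinarith [sq_nonneg r]
        exact h3
    refine ⟨0, Matrix.isSymm_zero, fun z hz => ?_⟩
    have h1 := hfK' z hz
    rw [neg_eq_zero.1 h0, hα] at h1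
    simp [power] at h1

open scoped Matrix.Norms.Elementwise in
/-- The Kalman–Yakubovich–Popov lemma for the supply rate `ẏᵀ u` of a controllable system. -/
theorem FrequencyInequality.exists_storage (hc : Controllable A B)
    (hF : FrequencyInequality A B C) :
    ∃ P : Matrix (Fin n) (Fin n) ℝ, P.IsSymm ∧ StorageInequality A B C P := by
  let S : ℕ → Set (Matrix (Fin n) (Fin n) ℝ) := fun k =>
    {P | P.IsSymm ∧ ∀ z ∈ unitPairs n m, power A B P z ≤ supply A B C z + 1 / ((k : ℝ) + 1)}
  have hcont : ∀ z : (Fin n → ℝ) × (Fin m → ℝ),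
      Continuous fun P : Matrix (Fin n) (Fin n) ℝ => power A B P z := by
    intro z
    exact continuous_const.dotProduct (continuous_id.matrix_mulVec continuous_const)
  have hsc : IsClosed {P : Matrix (Fin n) (Fin n) ℝ | P.IsSymm} :=
    isClosed_eq continuous_id.matrix_transpose continuous_id
  have hclosed : ∀ k, IsClosed (S k) := by
    intro k
    have : S k = {P : Matrix (Fin n) (Fin n) ℝ | P.IsSymm} ∩ ⋂ z ∈ unitPairs n m,
        {P | power A B P z ≤ supply A B C z + 1 / ((k : ℝ) + 1)} := by
      ext P; simp [S]
    rw [this]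
    exact hsc.inter (isClosed_biInter fun z _ => isClosed_le (hcont z) continuous_const)
  have hmono : ∀ k, S (k + 1) ⊆ S k := by
    rintro k P ⟨h1, h2⟩
    refine ⟨h1, fun z hz => (h2 z hz).trans ?_⟩
    have : 1 / (((k + 1 : ℕ) : ℝ) + 1) ≤ 1 / ((k : ℝ) + 1) := by
      apply one_div_le_one_div_of_le (by positivity)
      push_cast; linarith
    linarith
  have hne : ∀ k, (S k).Nonempty := fun k =>
    hF.exists_storage_slack hc (by positivity)
  -- An unbounded sequence, normalized, would have a limit L of norm one whose power is nowhere
  -- positive; controllability forces L = 0.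
  have hbdd : Bornology.IsBounded (S 0) := by
    by_contra hunb
    have hex : ∀ j : ℕ, ∃ Q ∈ S 0, (j : ℝ) + 1 < ‖Q‖ := by
      intro j
      by_contra hj
      push Not at hj
      exact hunb (isBounded_iff_forall_norm_le.2 ⟨_, hj⟩)
    choose Q hQ hQn using hex
    have hQpos : ∀ j, 0 < ‖Q j‖ := fun j => lt_trans (by positivity) (hQn j)
    let Y : ℕ → Matrix (Fin n) (Fin n) ℝ := fun j => ‖Q j‖⁻¹ • Q j
    have hY : ∀ j, Y j ∈ Metric.sphere (0 : Matrix (Fin n) (Fin n) ℝ) 1 := by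
      intro j
      rw [mem_sphere_zero_iff_norm, norm_smul, norm_inv, norm_norm, inv_mul_cancel₀ (hQpos j).ne']
    obtain ⟨L, hL, φ, hφ, hlim⟩ := (isCompact_sphere _ _).tendsto_subseq hY
    have hLs : L.IsSymm := hsc.mem_of_tendsto hlim
      (Filter.Eventually.of_forall fun j => ((hQ (φ j)).1.smul _))
    have hinv : Filter.Tendsto (fun j => ‖Q (φ j)‖⁻¹) Filter.atTop (𝓝 0) := by
      refine tendsto_inv_atTop_zero.comp ?_
      refine Filter.tendsto_atTop_mono (fun j => ?_) tendsto_natCast_atTop_atTop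
      have h1 := hQn (φ j)
      have h2 : (j : ℝ) ≤ φ j := by exact_mod_cast hφ.id_le j
      linarith
    have hLz : ∀ z ∈ unitPairs n m, power A B L z ≤ 0 := by
      intro z hz
      have h1 : Filter.Tendsto (fun j => ‖Q (φ j)‖⁻¹ * (supply A B C z + 1 / (((0 : ℕ) : ℝ) + 1)))
          Filter.atTop (𝓝 0) := by
        simpa using hinv.mul_const (supply A B C z + 1 / (((0 : ℕ) : ℝ) + 1))
      refine le_of_tendsto_of_tendsto' (((hcont z).tendsto L).comp hlim) h1 fun j => ?_
      have h2 : power A B (Y (φ j)) z = ‖Q (φ j)‖⁻¹ * power A B (Q (φ j)) z := by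
        simp only [Y, power, Matrix.smul_mulVec, dotProduct_smul, smul_eq_mul]
      simp only [Function.comp_apply, h2]
      exact mul_le_mul_of_nonneg_left ((hQ (φ j)).2 z hz) (inv_nonneg.2 (norm_nonneg _))
    have h0 : -L = 0 := by
      refine hc.eq_zero_of_monotone hLs.neg fun x u => ?_
      rcases exists_unitPairs_smul (x, u) with hz | ⟨r, hr, y, hy, hz⟩
      · rw [Prod.ext_iff] at hz
        have hx : x = 0 := hz.1
        simp [hx]
      · have h1 := hLz y hy
        have h2 : power A B (-L) (x, u) = -(r ^ 2 * power A B L y) := by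
          rw [hz, power_smul, power, Matrix.neg_mulVec, dotProduct_neg, ← power]; ring
        have h3 : 0 ≤ power A B (-L) (x, u) := by
          rw [h2]; nlinarith [sq_nonneg r]
        exact h3
    rw [neg_eq_zero.1 h0] at hL
    simp at hL
  obtain ⟨P, hP⟩ := IsCompact.nonempty_iInter_of_sequence_nonempty_isCompact_isClosed S hmono hne
    (Metric.isCompact_of_isClosed_isBounded (hclosed 0) hbdd) hclosed
  rw [Set.mem_iInter] at hP
  refine ⟨P, (hP 0).1, fun x u => ?_⟩
  have hz : ∀ z ∈ unitPairs n m, power A B P z ≤ supply A B C z := by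
    intro z hz
    have h1 : Filter.Tendsto (fun k : ℕ => supply A B C z + 1 / ((k : ℝ) + 1)) Filter.atTop
        (𝓝 (supply A B C z + 0)) :=
      tendsto_const_nhds.add tendsto_one_div_add_atTop_nhds_zero_nat
    rw [add_zero] at h1
    exact ge_of_tendsto' h1 fun k => (hP k).2 z hz
  rcases exists_unitPairs_smul (x, u) with h | ⟨r, hr, y, hy, h⟩
  · rw [Prod.ext_iff] at h
    have hx : x = 0 := h.1
    have hu : u = 0 := h.2
    simp [hx, hu]
  · have h1 : power A B P (x, u) ≤ supply A B C (x, u) := by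
      rw [h, power_smul, supply_smul]
      exact mul_le_mul_of_nonneg_left (hz y hy) (sq_nonneg r)
    exact h1

end NegImag

/-! ### From the negative imaginary property to a storage function -/

namespace NegImag

variable {n m : ℕ} {A : Matrix (Fin n) (Fin n) ℝ} {B : Matrix (Fin n) (Fin m) ℝ}
  {C : Matrix (Fin m) (Fin n) ℝ} {P : Matrix (Fin n) (Fin n) ℝ}

lemma reV_star (v : Fin n → ℂ) : reV (star v) = reV v := by ext; simp [reV]

lemma imV_star (v : Fin n → ℂ) : imV (star v) = -imV v := by ext; simp [imV]

lemma star_eigenvector {μ : ℂ} {v : Fin n → ℂ} (hv : toC A *ᵥ v = μ • v) :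
    toC A *ᵥ star v = star μ • star v := by
  rw [← star_toC_mulVec, hv, star_smul]

lemma frequency_nonneg_of_pos (hG : IsNegativeImaginary (transferFunction A B C)) {ω : ℝ}
    (hω : 0 < ω) (hreg : A.charpoly.eval₂ (algebraMap ℝ ℂ) (Complex.I * ω) ≠ 0)
    {x : Fin n → ℂ} {u : Fin m → ℂ} (h : toC A *ᵥ x + toC B *ᵥ u = (Complex.I * ω) • x) :
    0 ≤ (star (toC C *ᵥ (toC A *ᵥ x + toC B *ᵥ u)) ⬝ᵥ u).re := by
  have hp : ¬ IsPole (transferFunction A B C) (Complex.I * ω) := by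
    rintro ⟨i, j, hij⟩
    exact eval₂_denom_ne_zero hreg i j hij
  have h1 := (hG.nonneg ω hω hp).dotProduct_mulVec_nonneg u
  rw [form_smul_sub_conjTranspose, evalAt_mulVec hreg (x := x) (by rw [← h]; abel),
    Complex.zero_le_real] at h1
  rw [h, Matrix.mulVec_smul, ← star_star_dotProduct u, dotProduct_smul, smul_eq_mul,
    Complex.star_def, Complex.conj_re]
  linarith

lemma frequency_nonneg_of_regular (hG : IsNegativeImaginary (transferFunction A B C)) {ω : ℝ}
    (hreg : A.charpoly.eval₂ (algebraMap ℝ ℂ) (Complex.I * ω) ≠ 0)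
    {x : Fin n → ℂ} {u : Fin m → ℂ} (h : toC A *ᵥ x + toC B *ᵥ u = (Complex.I * ω) • x) :
    0 ≤ (star (toC C *ᵥ (toC A *ᵥ x + toC B *ᵥ u)) ⬝ᵥ u).re := by
  have hconj : star (Complex.I * ω) = Complex.I * ((-ω : ℝ) : ℂ) := by
    simp
  rcases lt_trichotomy ω 0 with hω | hω | hω
  · have hreg' : A.charpoly.eval₂ (algebraMap ℝ ℂ) (Complex.I * ((-ω : ℝ) : ℂ)) ≠ 0 := by
      intro h0
      obtain ⟨v, hv0, hv⟩ := eval₂_charpoly_eq_zero_iff.1 h0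
      refine hreg (eval₂_charpoly_eq_zero_iff.2 ⟨star v, star_ne_zero.2 hv0, ?_⟩)
      rw [star_eigenvector hv, ← hconj, star_star]
    have h' : toC A *ᵥ star x + toC B *ᵥ star u = (Complex.I * ((-ω : ℝ) : ℂ)) • star x := by
      rw [← star_toC_mulVec, ← star_toC_mulVec, ← star_add, h, star_smul, hconj]
    have h1 := frequency_nonneg_of_pos hG (neg_pos.2 hω) hreg' h'
    rw [← star_toC_mulVec, ← star_toC_mulVec, ← star_add, ← star_toC_mulVec,
      re_star_dotProduct, reV_star, reV_star, imV_star, imV_star, neg_dotProduct_neg] at h1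
    rwa [re_star_dotProduct]
  -- At zero frequency ẋ = 0, so the supply vanishes.
  · rw [h, hω]; simp
  · exact frequency_nonneg_of_pos hG hω hreg h

/-- Even at a pole, a sinusoidal pair is a limit of sinusoidal pairs at nearby regular frequencies,
built with the continuous right inverse. -/
lemma frequency_nonneg (hc : Controllable A B)
    (hG : IsNegativeImaginary (transferFunction A B C)) {ω : ℝ}
    {x : Fin n → ℂ} {u : Fin m → ℂ} (h : toC A *ᵥ x + toC B *ᵥ u = (Complex.I * ω) • x) :
    0 ≤ (star (toC C *ᵥ (toC A *ᵥ x + toC B *ᵥ u)) ⬝ᵥ u).re := by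
  obtain ⟨y, w, hy, hw, hyw⟩ := hc.exists_rightInverse x
  set c : ℂ := Complex.I * ω with hcdef
  let s : ℝ → ℂ := fun τ => Complex.I * τ
  have hs : Continuous s := by fun_prop
  let X : ℝ → Fin n → ℂ := fun τ => x + (s τ - c) • y (s τ)
  let U : ℝ → Fin m → ℂ := fun τ => u + (s τ - c) • w (s τ)
  have hX : Continuous X :=
    continuous_const.add ((hs.sub continuous_const).smul (hy.comp hs))
  have hU : Continuous U :=
    continuous_const.add ((hs.sub continuous_const).smul (hw.comp hs))
  have hXU : ∀ τ, toC A *ᵥ X τ + toC B *ᵥ U τ = s τ • X τ := by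
    intro τ
    have h1 := hyw (s τ)
    simp only [X, U, Matrix.mulVec_add, Matrix.mulVec_smul]
    linear_combination (norm := module) h + (s τ - c) • h1
  have hmv : ∀ {k l : ℕ} (M : Matrix (Fin k) (Fin l) ℝ) {f : ℝ → Fin l → ℂ}, Continuous f →
      Continuous fun τ => toC M *ᵥ f τ := fun M _ hf => continuous_const.matrix_mulVec hf
  have hcont : Continuous fun τ =>
      (star (toC C *ᵥ (toC A *ᵥ X τ + toC B *ᵥ U τ)) ⬝ᵥ U τ).re :=
    Complex.continuous_re.comp
      ((continuous_star.comp (hmv C ((hmv A hX).add (hmv B hU)))).dotProduct hU)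
  have hlim := (hcont.tendsto ω).mono_left (nhdsWithin_le_nhds (s := {ω}ᶜ))
  have hX0 : X ω = x := by simp [X, s, c]
  have hU0 : U ω = u := by simp [U, s, c]
  rw [hX0, hU0] at hlim
  have hsne : Filter.Tendsto s (𝓝[≠] ω) (𝓝[≠] c) := by
    refine tendsto_nhdsWithin_iff.2 ⟨(hs.tendsto ω).mono_left nhdsWithin_le_nhds, ?_⟩
    filter_upwards [self_mem_nhdsWithin] with τ hτ
    intro h0
    apply hτ
    have h0' : Complex.I * (τ : ℂ) = Complex.I * ω := h0
    exact_mod_cast mul_left_cancel₀ Complex.I_ne_zero h0'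
  refine ge_of_tendsto hlim ?_
  filter_upwards [hsne.eventually (eventually_charpoly_ne_zero A c)] with τ hτ
  exact frequency_nonneg_of_regular hG hτ (hXU τ)

lemma frequency_nonneg_infinity (hc : Controllable A B)
    (hG : IsNegativeImaginary (transferFunction A B C)) (u : Fin m → ℂ) :
    0 ≤ (star (toC C *ᵥ (toC B *ᵥ u)) ⬝ᵥ u).re := by
  let T : (Fin n → ℂ) →L[ℂ] (Fin n → ℂ) := (toC A).mulVecLin.toContinuousLinearMap
  have hT : ∀ x, toC A *ᵥ x = T x := fun _ => rfl
  -- Beyond ‖A‖ there are no eigenvalues, and the excess k + 1 bounds the response by ‖Bu‖ / (k +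
  -- 1), so it tends to 0.
  let ω : ℕ → ℝ := fun k => ‖T‖ + 1 + k
  have hω : ∀ k, 0 < ω k := fun k => by positivity
  have hnorm : ∀ k (x : Fin n → ℂ), ‖(Complex.I * (ω k : ℂ)) • x‖ = ω k * ‖x‖ := by
    intro k x
    rw [norm_smul, norm_mul, Complex.norm_I, Complex.norm_real, one_mul,
      Real.norm_of_nonneg (hω k).le]
  have hreg : ∀ k, A.charpoly.eval₂ (algebraMap ℝ ℂ) (Complex.I * (ω k : ℂ)) ≠ 0 := by
    intro k h0
    obtain ⟨v, hv0, hv⟩ := eval₂_charpoly_eq_zero_iff.1 h0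
    have h1 := congrArg norm hv
    rw [hnorm, hT] at h1
    have h2 := T.le_opNorm v
    have h3 := norm_pos_iff.2 hv0
    have h4 : (0 : ℝ) ≤ k := Nat.cast_nonneg k
    simp only [ω] at h1
    nlinarith
  choose x hx using fun k => exists_resolvent (hreg k) (toC B *ᵥ u)
  have hxk : ∀ k, ‖x k‖ ≤ ‖toC B *ᵥ u‖ * (1 / ((k : ℝ) + 1)) := by
    intro k
    have h1 : (Complex.I * (ω k : ℂ)) • x k = toC B *ᵥ u + T (x k) := by
      rw [← hx k, hT]; abel
    have h2 := congrArg norm h1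
    rw [hnorm] at h2
    have h3 := norm_add_le (toC B *ᵥ u) (T (x k))
    have h4 := T.le_opNorm (x k)
    have h5 : (0 : ℝ) < (k : ℝ) + 1 := by positivity
    rw [mul_one_div, le_div_iff₀ h5]
    simp only [ω] at h2
    nlinarith
  have hx0 : Filter.Tendsto x Filter.atTop (𝓝 0) := by
    refine squeeze_zero_norm hxk ?_
    simpa using tendsto_one_div_add_atTop_nhds_zero_nat.const_mul ‖toC B *ᵥ u‖
  have hcont : Continuous fun y : Fin n → ℂ =>
      (star (toC C *ᵥ (toC A *ᵥ y + toC B *ᵥ u)) ⬝ᵥ u).re := by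
    have hA : Continuous fun y : Fin n → ℂ => toC A *ᵥ y :=
      continuous_const.matrix_mulVec continuous_id
    have hC : Continuous fun y : Fin n → ℂ => toC C *ᵥ (toC A *ᵥ y + toC B *ᵥ u) :=
      continuous_const.matrix_mulVec (hA.add continuous_const)
    exact Complex.continuous_re.comp ((continuous_star.comp hC).dotProduct continuous_const)
  have hlim := (hcont.tendsto 0).comp hx0
  simp only [Matrix.mulVec_zero, zero_add] at hlim
  refine ge_of_tendsto' hlim fun k => ?_
  exact frequency_nonneg hc hG (ω := ω k) (by rw [← hx k]; abel)

lemma IsNegativeImaginary.frequencyInequality (hc : Controllable A B)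
    (hG : IsNegativeImaginary (transferFunction A B C)) : FrequencyInequality A B C := by
  rintro x u (rfl | ⟨ω, h⟩)
  · simpa using frequency_nonneg_infinity hc hG u
  · exact frequency_nonneg hc hG h

lemma energy_star (P : Matrix (Fin n) (Fin n) ℝ) (v : Fin n → ℂ) :
    energy P (star v) = energy P v := by
  rw [energy_eq, energy_eq, reV_star, imV_star, Matrix.mulVec_neg, neg_dotProduct_neg]

/-- Write v = Bu - (c - A)x with c = iω. The residue of G at c is K/c, so cCv = Ku, and the first
variation at v reduces to u*Ku = v*Pv. If this were zero, then Ku = 0 and Cv = 0, against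
observability. -/
lemma energy_pos_of_residue (hc : Controllable A B) (ho : Observable A B C)
    (hG : IsNegativeImaginary (transferFunction A B C)) (hP : P.IsSymm)
    (h : StorageInequality A B C P) {ω : ℝ} (hω : 0 < ω) {v : Fin n → ℂ} (hv0 : v ≠ 0)
    (hv : toC A *ᵥ v = (Complex.I * ω) • v) : 0 < energy P v := by
  obtain ⟨K, hK, hKpos⟩ := hG.residue ω hω ((isPole_iff hc ho).2 ⟨v, hv0, hv⟩)
  obtain ⟨x, u, hx, hu, hxu⟩ := hc.exists_rightInverse v
  set c : ℂ := Complex.I * ω with hcdef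
  have hc0 : c ≠ 0 := mul_ne_zero Complex.I_ne_zero (by exact_mod_cast hω.ne')
  have hL : Filter.Tendsto (fun s : ℂ => (s - c) • evalAt (transferFunction A B C) s)
      (𝓝[≠] c) (𝓝 (c⁻¹ • K)) := by
    have h1 : Filter.Tendsto (fun s : ℂ => s⁻¹) (𝓝[≠] c) (𝓝 c⁻¹) :=
      (tendsto_inv₀ hc0).mono_left nhdsWithin_le_nhds
    refine (h1.smul hK).congr' ?_
    filter_upwards [nhdsWithin_le_nhds (isOpen_ne.mem_nhds hc0)] with s hs
    have hs' : s ≠ 0 := hs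
    rw [smul_smul]
    congr 1
    field_simp
  have h1 := output_eq_residue hv hL hx hu hxu
  have h2 : c • (toC C *ᵥ v) = K *ᵥ u c := by
    rw [h1, Matrix.smul_mulVec, smul_smul, mul_inv_cancel₀ hc0, one_smul]
  have hcc : star c = -c := by simp [hcdef]
  have hvar := h.variation hP (v := v) (by
    rw [hv, Matrix.mulVec_smul, dotProduct_smul, star_dotProduct_self hP, smul_eq_mul,
      Complex.re_mul_ofReal]
    simp [hcdef]) (x c) (u c)
  have h3 : toC A *ᵥ x c + toC B *ᵥ u c = v + c • x c := by
    rw [← hxu c]; abel_nf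
  rw [hv, Matrix.mulVec_smul, h2, h3, Matrix.mulVec_add, dotProduct_add, Matrix.mulVec_smul,
    dotProduct_smul, star_smul, smul_dotProduct, hcc, star_dotProduct_self hP, add_assoc,
    neg_smul, add_neg_cancel, add_zero] at hvar
  have h4 := hKpos.dotProduct_mulVec_nonneg (u c)
  have h5 : star (u c) ⬝ᵥ (K *ᵥ u c) = (energy P v : ℂ) := by
    rw [← star_star_dotProduct, hvar, Complex.star_def, Complex.conj_ofReal]
  refine lt_of_le_of_ne ?_ fun h0 => hv0 ?_
  · rw [h5] at h4
    exact_mod_cast h4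
  · rw [← h0, Complex.ofReal_zero, hKpos.dotProduct_mulVec_zero_iff] at h5
    rw [h5] at h2
    exact ho.eq_zero hv ((smul_eq_zero.1 h2).resolve_left hc0)

/-- For Pv = 0 the first variation reads (CAv)*u = (Av)*Px for all x and u, so both sides vanish
identically. -/
lemma StorageInequality.kernel_invariant (h : StorageInequality A B C P) (hP : P.IsSymm)
    {v : Fin n → ℂ} (hv : toC P *ᵥ v = 0) :
    toC P *ᵥ (toC A *ᵥ v) = 0 ∧ toC C *ᵥ (toC A *ᵥ v) = 0 := by
  have h0 : ∀ y, star v ⬝ᵥ (toC P *ᵥ y) = 0 := fun y => by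
    rw [← star_dotProduct_symm hP, hv, dotProduct_zero, star_zero]
  have hvar := h.variation hP (v := v) (by rw [h0, Complex.zero_re])
  constructor
  · have h1 := hvar (toC P *ᵥ (toC A *ᵥ v)) 0
    rw [h0, dotProduct_zero, zero_add, ← star_dotProduct_symm hP, eq_comm, star_eq_zero,
      dotProduct_star_self_eq_zero] at h1
    exact h1
  · have h1 := hvar 0 (toC C *ᵥ (toC A *ᵥ v))
    rw [h0, Matrix.mulVec_zero, dotProduct_zero, zero_add,
      dotProduct_star_self_eq_zero] at h1
    exact h1

theorem IsNegativeImaginary.posDef_storage (hc : Controllable A B) (ho : Observable A B C)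
    (hG : IsNegativeImaginary (transferFunction A B C)) (hP : P.IsSymm)
    (h : StorageInequality A B C P) : P.PosDef := by
  have hzero : ∀ v : Fin n → ℂ, v ≠ 0 → toC A *ᵥ v ≠ 0 := fun v hv0 hv =>
    hG.no_pole_zero ((isPole_iff hc ho).2 ⟨v, hv0, by rw [hv, zero_smul]⟩)
  have hnonneg : ∀ x : Fin n → ℂ, 0 ≤ energy P x := by
    refine energy_nonneg_of_lyapunov hP (toC A).mulVecLin ?_ ?_ ?_
    · intro x
      simpa using h.complex x 0
    · intro μ v hv0 hv
      by_contra hμ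
      exact hG.no_pole_right μ (not_le.1 hμ) ((isPole_iff hc ho).2 ⟨v, hv0, hv⟩)
    · intro μ v hv0 hμ hv
      rw [Matrix.mulVecLin_apply] at hv
      have hμ' : μ = Complex.I * (μ.im : ℂ) := by
        apply Complex.ext <;> simp [hμ]
      rcases lt_trichotomy μ.im 0 with hlt | heq | hgt
      · rw [← energy_star]
        refine energy_pos_of_residue hc ho hG hP h (neg_pos.2 hlt) (star_ne_zero.2 hv0) ?_
        rw [star_eigenvector hv]
        congr 1
        rw [hμ']; simp
      · rw [heq] at hμ'
        exact absurd (by rw [hv, hμ']; simp) (hzero v hv0)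
      · exact energy_pos_of_residue hc ho hG hP h hgt hv0 (by rw [← hμ']; exact hv)
  -- A nonzero kernel is invariant under A and contains an eigenvector v with μCv = 0. As 0 is not a
  -- pole, μ ≠ 0, so Cv = 0, against observability.
  have hinj : ∀ v : Fin n → ℂ, toC P *ᵥ v = 0 → v = 0 := by
    let N : Submodule ℂ (Fin n → ℂ) := LinearMap.ker (toC P).mulVecLin
    have hN : ∀ w, w ∈ N ↔ toC P *ᵥ w = 0 := fun w => LinearMap.mem_ker
    by_contra hne
    push Not at hne
    obtain ⟨w, hw, hw0⟩ := hne
    have hnt : Nontrivial N := ⟨⟨⟨w, hw⟩, 0, fun h0 => hw0 (congrArg Subtype.val h0)⟩⟩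
    have hinv : ∀ w ∈ N, (toC A).mulVecLin w ∈ N := fun w hw =>
      (h.kernel_invariant hP ((hN w).1 hw)).1
    obtain ⟨μ, hμ⟩ := Module.End.exists_eigenvalue ((toC A).mulVecLin.restrict hinv)
    obtain ⟨v, hv⟩ := hμ.exists_hasEigenvector
    have h1 : toC A *ᵥ (v : Fin n → ℂ) = μ • (v : Fin n → ℂ) :=
      congrArg Subtype.val hv.apply_eq_smul
    have hv0 : (v : Fin n → ℂ) ≠ 0 := fun h0 => hv.2 (Subtype.ext h0)
    have h2 := (h.kernel_invariant hP ((hN _).1 v.2)).2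
    rw [h1, Matrix.mulVec_smul] at h2
    have hμ0 : μ ≠ 0 := fun h0 => hzero _ hv0 (by rw [h1, h0, zero_smul])
    exact hv0 (ho.eq_zero h1 ((smul_eq_zero.1 h2).resolve_left hμ0))
  have hherm : P.IsHermitian := by
    rw [Matrix.IsHermitian, Matrix.conjTranspose_eq_transpose_of_trivial]; exact hP
  have hre : ∀ x : Fin n → ℝ, 0 ≤ star x ⬝ᵥ (P *ᵥ x) := fun x => by
    have := hnonneg (vecC x)
    rw [energy_eq] at this
    simpa using this
  have hpsd : P.PosSemidef := .of_dotProduct_mulVec_nonneg hherm hre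
  refine .of_dotProduct_mulVec_pos hherm fun x hx => lt_of_le_of_ne (hre x) fun h0 => hx ?_
  have h1 := (hpsd.dotProduct_mulVec_zero_iff x).1 h0.symm
  have h2 := hinj (vecC x) (by rw [toC_mulVec_vecC, h1]; ext; simp [vecC])
  have h3 := congrArg reV h2
  rw [reV_vecC] at h3
  rw [h3]; ext; simp [reV]

end NegImag

theorem lemma4 (n m : ℕ) (A : Matrix (Fin n) (Fin n) ℝ) (B : Matrix (Fin n) (Fin m) ℝ)
    (C : Matrix (Fin m) (Fin n) ℝ)
    (hcontrollable : NegImag.Controllable A B) (hobservable : NegImag.Observable A B C) :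
    NegImag.IsNegativeImaginary (NegImag.transferFunction A B C) ↔
      ∃ P : Matrix (Fin n) (Fin n) ℝ, P.PosDef ∧
        NegImag.Dissipative A B C (NegImag.storage P) := by
  constructor
  · intro hG
    obtain ⟨P, hP, h⟩ := (hG.frequencyInequality hcontrollable).exists_storage hcontrollable
    exact ⟨P, hG.posDef_storage hcontrollable hobservable hP h, (NegImag.dissipative_iff hP).2 h⟩
  · rintro ⟨P, hP, h⟩
    exact ((NegImag.dissipative_iff (NegImag.isSymm_of_posDef hP)).1 h).isNegativeImaginary
      hcontrollable hobservable hP
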